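/- Let $X\subset\mathbb R^d$ be a compact set at each of whose points the tangent cone spans $\mathbb R^d$ (for instance a compact convex set with non-empty interior), so that gradients of $C^1$ functions on $X$ are well defined. Let $k:X\times X\to\mathbb R$ be a measurable symmetric positive definite kernel (that is, $\sum_{i,j}a_ia_jk(x_j,x_i)\ge 0$ for all finite families) with $\int_X k(x,x)\,dx<\infty$, and let $\mathcal K f(x)=\int_X k(x,y)f(y)\,dy$ be its integral operator on $L^2(X,dx)$. For a function $\eta$ on $X$, $\mathcal K^{-1}\eta$ denotes a function $f\in L^2(X,dx)$ with $\mathcal K f=\eta$ almost everywhere on $X$ (any one, if $\mathcal K$ is not injective). Let $\alpha,\beta,\lambda>0$ and let $\pi$ be a probability measure on $X$. Suppose that one of the following holds: 1. $\pi$ satisfies the logarithmic Sobolev inequality $$\Big\|\nabla\log\frac{d\mu}{d\pi}\Big\|^2_{L^2(\mu)}\ \ge\ 2\lambda\, \mathrm{D}_{\mathrm{KL}}(\mu|\pi)$$ for all probability measures $\mu$ with a positive $C^1$ density $d\mu/d\pi$ on $X$; or 2. $\pi$ is $\lambda$-log-concave: $X$ is convex and $\pi=e^{-V}dx$ on $X$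 with $\nabla^2V\ge\lambda\cdot\mathrm{Id}$, in the sense that $V-\frac{\lambda}{2}\|x\|^2$ is convex on the interior of $X$. Let $(\mu_t)_{t\ge0}$ be a spherical interaction-force transport (spherical IFT) gradient flow of $\mathrm{D}_{\mathrm{KL}}(\cdot|\pi)$, i.e. a curve of probability measures on $X$ with $$\partial_t\mu_t=\alpha\,\mathrm{div}\big(\mu_t\nabla\xi_t\big)-\beta\,\mathcal K^{-1}\Big(\xi_t-\frac{\int_X\mathcal K^{-1}\xi_t\,dx}{\int_X\mathcal K^{-1}1\,dx}\Big),\qquad \xi_t=\log\frac{d\mu_t}{d\pi},\qquad t>0,$$ with vanishing flux through the boundary, in the following sense. The densities $\rho_t=d\mu_t/d\pi$, $t\ge0$, form a continuous curve in $L^2(\pi)$; for every $t>0$ the density $\rho_t$ is positive and of class $C^1$ on $X$, the functions $\xi_t$, $1$ and $\eta_t=\xi_t-\int_X\mathcal K^{-1}\xi_t\,dx\big/\int_X\mathcal K^{-1}1\,dx$ are in the range of $\mathcal K$; and for every $t>0$ and every $\varphi\in C^1(X)$, $$\frac{d}{dt}\int\varphi\,d\mu_t=-\alpha\int\nabla\varphi\cdot\nabla\xi_t\,d\mu_t-\beta\int_X\varphi\,\mathcal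 K^{-1}\eta_t\,dx .$$ Then for all $t\ge0$ $$\mathrm{D}_{\mathrm{KL}}(\mu_t|\pi)\ \le\ e^{-2\alpha\lambda t}\,\mathrm{D}_{\mathrm{KL}}(\mu_0|\pi).$$ -/

import Mathlib

open MeasureTheory Set Filter Topology InformationTheory

noncomputable section

namespace SIFT

/-- A measurable symmetric positive definite kernel on `X` that is square-integrable with respect
to the Lebesgue measure on `X`, i.e. `∫_X k(x, x) dx < ∞`. -/
structure IsPDKernel {d : ℕ} (X : Set (EuclideanSpace ℝ (Fin d)))
    (k : EuclideanSpace ℝ (Fin d) → EuclideanSpace ℝ (Fin d) → ℝ) : Prop where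
  measurable : Measurable (Function.uncurry k)
  symm : ∀ x ∈ X, ∀ y ∈ X, k x y = k y x
  nonneg : ∀ (n : ℕ) (a : Fin n → ℝ) (x : Fin n → EuclideanSpace ℝ (Fin d)),
    (∀ i, x i ∈ X) → 0 ≤ ∑ i, ∑ j, a i * a j * k (x j) (x i)
  integrable_diag : IntegrableOn (fun x => k x x) X volume

/-- The integral operator `(K f)(x) = ∫_X k(x, y) f(y) dy` of the Lebesgue measure on `X`. -/
def kernelOp {d : ℕ} (X : Set (EuclideanSpace ℝ (Fin d)))
    (k : EuclideanSpace ℝ (Fin d) → EuclideanSpace ℝ (Fin d) → ℝ)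
    (f : EuclideanSpace ℝ (Fin d) → ℝ) (x : EuclideanSpace ℝ (Fin d)) : ℝ :=
  ∫ y in X, k x y * f y

/-- `f = K⁻¹ η`, for the integral operator `K` on `L²(X, dx)`: `f` is square-integrable on `X` and
`K f = η` almost everywhere on `X`. (If `K` is not injective, any preimage is admitted.) -/
def IsKernelInv {d : ℕ} (X : Set (EuclideanSpace ℝ (Fin d)))
    (k : EuclideanSpace ℝ (Fin d) → EuclideanSpace ℝ (Fin d) → ℝ)
    (η f : EuclideanSpace ℝ (Fin d) → ℝ) : Prop :=
  MemLp f 2 (volume.restrict X) ∧ ∀ᵐ x ∂(volume.restrict X), kernelOp X k f x = η x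

/-- The measure with density `ρ` with respect to `π`. -/
def ofDensity {d : ℕ} (π : Measure (EuclideanSpace ℝ (Fin d)))
    (ρ : EuclideanSpace ℝ (Fin d) → ℝ) : Measure (EuclideanSpace ℝ (Fin d)) :=
  π.withDensity (fun x => ENNReal.ofReal (ρ x))

/-- The logarithmic Sobolev inequality with constant `c` for `π` on `X`:
`‖∇ log (dμ/dπ)‖²_{L²(μ)} ≥ c · KL(μ|π)` for all probability measures `μ` that have a positive
continuously differentiable density `ρ = dμ/dπ` on `X`. -/
def LogSobolev {d : ℕ} (X : Set (EuclideanSpace ℝ (Fin d)))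
    (π : Measure (EuclideanSpace ℝ (Fin d))) (c : ℝ) : Prop :=
  ∀ ρ : EuclideanSpace ℝ (Fin d) → ℝ, ContDiffOn ℝ 1 ρ X → (∀ x ∈ X, 0 < ρ x) →
    IsProbabilityMeasure (ofDensity π ρ) →
    ENNReal.ofReal c * klDiv (ofDensity π ρ) π ≤
      ∫⁻ x, ‖gradientWithin (fun y => Real.log (ρ y)) X x‖ₑ ^ 2 ∂(ofDensity π ρ)

/-- `π` is `lam`-log-concave on the convex set `X`: `π = e^{-V} dx` on `X` with `∇²V ≥ lam · Id`,
in the sense that `V - (lam / 2) ‖x‖²` is convex on the interior of `X` (for a `V` of class `C²`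
this is the inequality of Hessians; the boundary of a convex set is Lebesgue-null). -/
def IsLogConcave {d : ℕ} (X : Set (EuclideanSpace ℝ (Fin d)))
    (π : Measure (EuclideanSpace ℝ (Fin d))) (lam : ℝ) : Prop :=
  Convex ℝ X ∧ ∃ V : EuclideanSpace ℝ (Fin d) → ℝ,
    StrongConvexOn (interior X) lam V ∧
      π = ofDensity (volume.restrict X) (fun x => Real.exp (-V x))

/-- `μ` solves at time `t` the equation
`∂ₜμ = α div(μ ∇ξ) - β K⁻¹(ξ - (∫ K⁻¹ξ) / (∫ K⁻¹1))`, tested against all functions `φ` of class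
`C¹` on `X` (so that the flux across the boundary of `X` vanishes). -/
def SolvesSphericalIFTAt {d : ℕ} (X : Set (EuclideanSpace ℝ (Fin d)))
    (k : EuclideanSpace ℝ (Fin d) → EuclideanSpace ℝ (Fin d) → ℝ) (α β : ℝ)
    (μ : ℝ → Measure (EuclideanSpace ℝ (Fin d))) (ξ : EuclideanSpace ℝ (Fin d) → ℝ)
    (t : ℝ) : Prop :=
  ∃ f g h : EuclideanSpace ℝ (Fin d) → ℝ,
    IsKernelInv X k ξ f ∧
    IsKernelInv X k (fun _ => 1) g ∧
    IsKernelInv X k (fun x => ξ x - (∫ y in X, f y) / (∫ y in X, g y)) h ∧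
    ∀ φ : EuclideanSpace ℝ (Fin d) → ℝ, ContDiffOn ℝ 1 φ X →
      HasDerivAt (fun s => ∫ x, φ x ∂(μ s))
        (-(α * ∫ x, inner ℝ (gradientWithin φ X x) (gradientWithin ξ X x) ∂(μ t))
          - β * ∫ x in X, φ x * h x) t

/-- The curve `μ : [0, ∞) → 𝒫(X)` is a spherical interaction-force transport gradient flow of the
energy `KL(·|π)`. Its density `ρ t = dμ_t/dπ` is continuous in time with values in `L²(π)`, for
`t > 0` it is positive and of class `C¹` on `X`, and then `μ` solves the flow equation with the
first variation `log (dμ_t/dπ)` of the energy. -/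
def IsSphericalIFTFlowKL {d : ℕ} (X : Set (EuclideanSpace ℝ (Fin d)))
    (k : EuclideanSpace ℝ (Fin d) → EuclideanSpace ℝ (Fin d) → ℝ) (α β : ℝ)
    (π : Measure (EuclideanSpace ℝ (Fin d)))
    (μ : ℝ → Measure (EuclideanSpace ℝ (Fin d))) : Prop :=
  ∃ ρ : ℝ → EuclideanSpace ℝ (Fin d) → ℝ,
    (∀ t, 0 ≤ t → IsProbabilityMeasure (μ t) ∧ μ t = ofDensity π (ρ t)) ∧
    (∀ t, 0 ≤ t → (∀ x ∈ X, 0 ≤ ρ t x) ∧ MemLp (ρ t) 2 π ∧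
      Tendsto (fun s => eLpNorm (ρ s - ρ t) 2 π) (𝓝[Ici 0] t) (𝓝 0)) ∧
    (∀ t, 0 < t → ContDiffOn ℝ 1 (ρ t) X ∧ (∀ x ∈ X, 0 < ρ t x) ∧
      SolvesSphericalIFTAt X k α β μ (fun x => Real.log (ρ t x)) t)

end SIFT

end

/-! The proof is entropy dissipation. Write `E t = ∫ klFun (ρ t) dπ` for the divergence and `ξ = log
(ρ t)`. Testing the equation at time `t` with `φ = 1` shows that the reaction `h = K⁻¹η` has zero
integral, so `∫ ξ h = ∫ η h = ∫ (K h) h`, which is nonnegative for a positive definite kernel. The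
reaction therefore only helps, and testing with `φ = ξ` gives a derivative at most `-α ∫ ‖∇ξ‖² dμ_t
≤ -2αλ E t` by the logarithmic Sobolev inequality.

The density is not assumed differentiable in time, so `E` itself is never differentiated. Convexity
of `klFun` gives `E s ≥ E t + ∫ ξ dμ_s - ∫ ξ dμ_t`: a lower support of `E` at `t`, differentiable
there with the slope just found. Together with continuity of `E`, which follows from continuity in
`L²(π)`, this suffices for Grönwall (`le_exp_mul_of_forall_support`).

Two further ingredients: `IsLogConcave.logSobolev` deduces the Sobolev inequality from log-concavity
through Prékopa–Leindler (the Bobkov–Ledoux argument), and `integral_integral_nonneg_of_posDef`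
passes from finite positive definiteness to integrals by averaging over independent random points.
-/

namespace SIFT

open scoped ENNReal NNReal Pointwise

/-! ### The Prékopa–Leindler inequality -/

/-- The Prékopa–Leindler inequality for a measure on a real vector space. -/
def PrekopaLeindler {E : Type*} [AddCommGroup E] [Module ℝ E] [MeasurableSpace E]
    (μ : Measure E) : Prop :=
  ∀ ⦃t s : ℝ⦄, 0 < t → 0 < s → t + s = 1 → ∀ ⦃f g h : E → ℝ≥0∞⦄,
    Measurable f → Measurable g → Measurable h →
    (∀ x y, f x ^ t * g y ^ s ≤ h (t • x + s • y)) →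
    (∫⁻ x, f x ∂μ) ^ t * (∫⁻ x, g x ∂μ) ^ s ≤ ∫⁻ x, h x ∂μ

/-- One-dimensional Brunn–Minkowski: the translates `K + min L` and `max K + L` lie in `K + L` and
share only the point `max K + min L`. -/
theorem volume_add_volume_le_volume_add {K L : Set ℝ} (hK : IsCompact K) (hL : IsCompact L)
    (hK0 : K.Nonempty) (hL0 : L.Nonempty) : volume K + volume L ≤ volume (K + L) := by
  obtain ⟨a, haK, ha⟩ := hK.exists_isGreatest hK0
  obtain ⟨b, hbL, hb⟩ := hL.exists_isLeast hL0
  have h1 : volume ((fun x => x + b) '' K) = volume K := by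
    rw [image_add_right, measure_preimage_add_right]
  have h2 : volume ((fun x => a + x) '' L) = volume L := by
    rw [image_add_left, measure_preimage_add]
  have hd : AEDisjoint volume ((fun x => x + b) '' K) ((fun x => a + x) '' L) := by
    refine measure_mono_null (t := {a + b}) ?_ (by simp)
    rintro _ ⟨⟨x, hx, rfl⟩, ⟨y, hy, hxy⟩⟩
    have := ha hx
    have := hb hy
    simp only [mem_singleton_iff] at *
    linarith
  have hLm : NullMeasurableSet ((fun x => a + x) '' L) volume :=
    (hL.image (by fun_prop)).measurableSet.nullMeasurableSet
  rw [← h1, ← h2, ← measure_union₀ hLm hd]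
  refine measure_mono (union_subset ?_ ?_)
  · rintro _ ⟨x, hx, rfl⟩
    exact add_mem_add hx hbL
  · rintro _ ⟨x, hx, rfl⟩
    exact add_mem_add haK hx

theorem ofReal_mul_volume_add_le {A B C : Set ℝ} {t s : ℝ} (ht : 0 < t) (hs : 0 < s)
    (hA : MeasurableSet A) (hB : MeasurableSet B) (hA0 : A.Nonempty) (hB0 : B.Nonempty)
    (h : ∀ x ∈ A, ∀ y ∈ B, t * x + s * y ∈ C) :
    ENNReal.ofReal t * volume A + ENNReal.ofReal s * volume B ≤ volume C := by
  obtain ⟨a, ha⟩ := hA0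
  obtain ⟨b, hb⟩ := hB0
  rw [hA.measure_eq_iSup_isCompact, hB.measure_eq_iSup_isCompact]
  simp only [ENNReal.mul_iSup, iSup_and']
  refine ENNReal.biSup_add_biSup_le' ⟨∅, by simp⟩ ⟨∅, by simp⟩ ?_
  rintro K ⟨hKA, hK⟩ L ⟨hLB, hL⟩
  -- The compact approximants may be empty; adding one point of `A` and of `B` makes them nonempty.
  have hK' := hK.insert a
  have hL' := hL.insert b
  have e1 : ∀ {r : ℝ} (_ : 0 < r) (S : Set ℝ), ENNReal.ofReal r * volume S = volume (r • S) := by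
    intro r hr S
    rw [Measure.addHaar_smul]
    simp [abs_of_pos hr]
  calc ENNReal.ofReal t * volume K + ENNReal.ofReal s * volume L
      ≤ ENNReal.ofReal t * volume (insert a K) + ENNReal.ofReal s * volume (insert b L) := by
        gcongr <;> exact subset_insert _ _
    _ = volume (t • insert a K) + volume (s • insert b L) := by rw [e1 ht, e1 hs]
    _ ≤ volume (t • insert a K + s • insert b L) :=
        volume_add_volume_le_volume_add (hK'.smul t) (hL'.smul s)
          ((insert_nonempty a K).smul_set) ((insert_nonempty b L).smul_set)
    _ ≤ volume C := by
        refine measure_mono ?_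
        rintro _ ⟨_, ⟨x, hx, rfl⟩, _, ⟨y, hy, rfl⟩, rfl⟩
        exact h x (insert_subset ha hKA hx) y (insert_subset hb hLB hy)

theorem lintegral_eq_lintegral_Ioo_meas_lt {α : Type*} [MeasurableSpace α] (μ : Measure α)
    {f : α → ℝ≥0∞} (hf : Measurable f) (h1 : ∀ x, f x ≤ 1) :
    ∫⁻ x, f x ∂μ = ∫⁻ r in Ioo (0 : ℝ) 1, μ {x | ENNReal.ofReal r < f x} := by
  have htop : ∀ x, f x ≠ ∞ := fun x => ((h1 x).trans_lt ENNReal.one_lt_top).ne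
  have e : ∫⁻ x, f x ∂μ = ∫⁻ x, ENNReal.ofReal (f x).toReal ∂μ :=
    lintegral_congr fun x => (ENNReal.ofReal_toReal (htop x)).symm
  rw [e, lintegral_eq_lintegral_meas_lt μ (ae_of_all _ fun x => ENNReal.toReal_nonneg)
    hf.ennreal_toReal.aemeasurable]
  rw [← Ioo_union_Ici_eq_Ioi (zero_lt_one' ℝ), lintegral_union measurableSet_Ici]
  · have hz : ∫⁻ r in Ici (1 : ℝ), μ {x | r < (f x).toReal} = 0 := by
      rw [setLIntegral_congr_fun measurableSet_Ici (g := fun _ => 0), lintegral_zero]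
      intro r hr
      have : {x | r < (f x).toReal} = ∅ := by
        ext x
        have : (f x).toReal ≤ 1 := ENNReal.toReal_le_of_le_ofReal zero_le_one (by simpa using h1 x)
        simpa using this.trans hr
      simp [this]
    rw [hz, add_zero]
    refine setLIntegral_congr_fun measurableSet_Ioo fun r hr => ?_
    congr 1
    ext x
    simp only [mem_ofPred_eq]
    rw [ENNReal.ofReal_lt_iff_lt_toReal hr.1.le (htop x)]
  · exact disjoint_left.2 fun x hx hx' => absurd hx.2 (not_lt.2 hx')

theorem ennreal_geom_mean_le_arith_mean2 {t s : ℝ} (ht : 0 < t) (hs : 0 < s) (hts : t + s = 1)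
    (a b : ℝ≥0∞) : a ^ t * b ^ s ≤ ENNReal.ofReal t * a + ENNReal.ofReal s * b := by
  have hc : (t⁻¹).HolderConjugate s⁻¹ := by
    rw [Real.holderConjugate_iff]
    refine ⟨?_, by simpa⟩
    rw [one_lt_inv₀ ht]
    linarith
  have := ENNReal.young_inequality (a ^ t) (b ^ s) hc
  rwa [← ENNReal.rpow_mul, ← ENNReal.rpow_mul, mul_inv_cancel₀ ht.ne', mul_inv_cancel₀ hs.ne',
    ENNReal.rpow_one, ENNReal.rpow_one, ENNReal.ofReal_inv_of_pos ht, ENNReal.ofReal_inv_of_pos hs,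
    div_eq_mul_inv, div_eq_mul_inv, inv_inv, inv_inv, mul_comm a, mul_comm b] at this

/-- With both suprema equal to `1`, the superlevel sets of `f` and `g` are nonempty at every level
`r < 1`. Brunn–Minkowski compares them with those of `h` level by level, and the layer-cake formula
integrates the result. -/
theorem ofReal_mul_lintegral_add_le_of_iSup_eq_one {t s : ℝ} (ht : 0 < t) (hs : 0 < s)
    (hts : t + s = 1) {f g h : ℝ → ℝ≥0∞} (hf : Measurable f) (hg : Measurable g)
    (hh : Measurable h) (hf1 : ⨆ x, f x = 1) (hg1 : ⨆ x, g x = 1)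
    (H : ∀ x y, f x ^ t * g y ^ s ≤ h (t * x + s * y)) :
    ENNReal.ofReal t * (∫⁻ x, f x) + ENNReal.ofReal s * (∫⁻ x, g x) ≤ ∫⁻ x, h x := by
  have hle : ∫⁻ x, min (h x) 1 ≤ ∫⁻ x, h x := lintegral_mono fun x => min_le_left _ _
  refine le_trans ?_ hle
  rw [lintegral_eq_lintegral_Ioo_meas_lt volume hf fun x => hf1 ▸ le_iSup f x,
    lintegral_eq_lintegral_Ioo_meas_lt volume hg fun x => hg1 ▸ le_iSup g x,
    lintegral_eq_lintegral_Ioo_meas_lt volume (hh.min measurable_const) fun x => min_le_right _ _,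
    ← lintegral_const_mul' _ _ ENNReal.ofReal_ne_top,
    ← lintegral_const_mul' _ _ ENNReal.ofReal_ne_top, ← lintegral_add_left]
  · refine setLIntegral_mono' measurableSet_Ioo fun r hr => ?_
    have hr1 : ENNReal.ofReal r < 1 := by simpa using hr.2
    have hr0 : ENNReal.ofReal r ≠ 0 := by simpa using hr.1
    refine ofReal_mul_volume_add_le ht hs (measurableSet_lt measurable_const hf)
      (measurableSet_lt measurable_const hg) ?_ ?_ ?_
    · exact lt_iSup_iff.1 (hf1 ▸ hr1)
    · exact lt_iSup_iff.1 (hg1 ▸ hr1)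
    · intro x hx y hy
      refine lt_min (lt_of_lt_of_le ?_ (H x y)) hr1
      have e : ENNReal.ofReal r = ENNReal.ofReal r ^ t * ENNReal.ofReal r ^ s := by
        rw [← ENNReal.rpow_add _ _ hr0 ENNReal.ofReal_ne_top, hts, ENNReal.rpow_one]
      rw [e]
      exact ENNReal.mul_lt_mul (ENNReal.rpow_lt_rpow hx ht) (ENNReal.rpow_lt_rpow hy hs)
  · refine Measurable.const_mul (Antitone.measurable fun a b hab => measure_mono fun x hx => ?_) _
    exact lt_of_le_of_lt (ENNReal.ofReal_le_ofReal hab) hx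

/-- Dividing by the suprema reduces to the additive inequality; weighted AM–GM turns it into the
multiplicative one, which is homogeneous, so the normalisation cancels. -/
theorem prekopaLeindler_real_of_bounded {t s : ℝ} (ht : 0 < t) (hs : 0 < s)
    (hts : t + s = 1) {f g h : ℝ → ℝ≥0∞} (hf : Measurable f) (hg : Measurable g)
    (hh : Measurable h) (hf1 : ⨆ x, f x ≠ ∞) (hg1 : ⨆ x, g x ≠ ∞)
    (H : ∀ x y, f x ^ t * g y ^ s ≤ h (t * x + s * y)) :
    (∫⁻ x, f x) ^ t * (∫⁻ x, g x) ^ s ≤ ∫⁻ x, h x := by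
  set a := ⨆ x, f x with ha
  set b := ⨆ x, g x with hb
  by_cases ha0 : a = 0
  · have : f = 0 := by
      ext x
      exact (ENNReal.iSup_eq_zero.1 ha0) x
    simp [this, ht]
  by_cases hb0 : b = 0
  · have : g = 0 := by
      ext x
      exact (ENNReal.iSup_eq_zero.1 hb0) x
    simp [this, hs]
  have hat0 : a ^ t ≠ 0 := by simp [ha0, hf1]
  have hbs0 : b ^ s ≠ 0 := by simp [hb0, hg1]
  have hat : a ^ t ≠ ∞ := ENNReal.rpow_ne_top_of_nonneg ht.le hf1
  have hbs : b ^ s ≠ ∞ := ENNReal.rpow_ne_top_of_nonneg hs.le hg1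
  have hc0 : a ^ t * b ^ s ≠ 0 := mul_ne_zero hat0 hbs0
  have hc : a ^ t * b ^ s ≠ ∞ := ENNReal.mul_ne_top hat hbs
  have key := ofReal_mul_lintegral_add_le_of_iSup_eq_one ht hs hts (hf.const_mul a⁻¹)
    (hg.const_mul b⁻¹) (hh.const_mul (a ^ t * b ^ s)⁻¹)
    (by rw [← ENNReal.mul_iSup, ← ha, ENNReal.inv_mul_cancel ha0 hf1])
    (by rw [← ENNReal.mul_iSup, ← hb, ENNReal.inv_mul_cancel hb0 hg1]) (by
      intro x y
      rw [ENNReal.mul_rpow_of_nonneg _ _ ht.le, ENNReal.mul_rpow_of_nonneg _ _ hs.le,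
        mul_mul_mul_comm, ENNReal.inv_rpow, ENNReal.inv_rpow,
        ← ENNReal.mul_inv (Or.inl hat0) (Or.inl hat)]
      gcongr
      exact H x y)
  rw [lintegral_const_mul _ hf, lintegral_const_mul _ hg, lintegral_const_mul _ hh] at key
  have key2 := (ennreal_geom_mean_le_arith_mean2 ht hs hts _ _).trans key
  rw [ENNReal.mul_rpow_of_nonneg _ _ ht.le, ENNReal.mul_rpow_of_nonneg _ _ hs.le,
    mul_mul_mul_comm, ENNReal.inv_rpow, ENNReal.inv_rpow,
    ← ENNReal.mul_inv (Or.inl hat0) (Or.inl hat)] at key2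
  have key3 := mul_le_mul_right key2 (a ^ t * b ^ s)
  rwa [ENNReal.mul_inv_cancel_left hc0 hc, ENNReal.mul_inv_cancel_left hc0 hc] at key3

theorem tendsto_lintegral_min_natCast {α : Type*} [MeasurableSpace α] (μ : Measure α)
    {f : α → ℝ≥0∞} (hf : Measurable f) :
    Tendsto (fun n : ℕ => ∫⁻ x, min (f x) n ∂μ) atTop (𝓝 (∫⁻ x, f x ∂μ)) := by
  refine lintegral_tendsto_of_tendsto_of_monotone (fun n => by fun_prop) ?_ ?_
  · exact ae_of_all _ fun x m n hmn => min_le_min_left _ (by exact_mod_cast hmn)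
  · refine ae_of_all _ fun x => ?_
    have h : Tendsto (fun n : ℕ => min (f x) (n : ℝ≥0∞)) atTop (𝓝 (min (f x) ∞)) :=
      tendsto_const_nhds.min ENNReal.tendsto_nat_nhds_top
    simpa using h

theorem prekopaLeindler_real : PrekopaLeindler (volume : Measure ℝ) := by
  intro t s ht hs hts f g h hf hg hh H
  -- Zero integrals are set aside because the limit of the product below must avoid `0 · ∞`.
  by_cases hf0 : ∫⁻ x, f x = 0
  · simp [hf0, ht]
  by_cases hg0 : ∫⁻ x, g x = 0
  · simp [hg0, hs]
  have h1 := ((ENNReal.continuous_rpow_const (y := t)).tendsto _).comp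
    (tendsto_lintegral_min_natCast volume hf)
  have h2 := ((ENNReal.continuous_rpow_const (y := s)).tendsto _).comp
    (tendsto_lintegral_min_natCast volume hg)
  have h3 := ENNReal.Tendsto.mul h1 (Or.inl (by simp [hf0, ht.not_gt])) h2
    (Or.inl (by simp [hg0, hs.not_gt]))
  refine le_of_tendsto' h3 fun n => ?_
  have hb : ∀ u : ℝ → ℝ≥0∞, ⨆ x, min (u x) (n : ℝ≥0∞) ≠ ∞ := fun u =>
    ((iSup_le fun x => min_le_right _ _).trans_lt (ENNReal.natCast_lt_top n)).ne
  refine prekopaLeindler_real_of_bounded ht hs hts (hf.min measurable_const)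
    (hg.min measurable_const) hh (hb f) (hb g) fun x y => le_trans ?_ (H x y)
  gcongr <;> exact min_le_left _ _

/-- The inequality for `μ` on fibres is exactly the hypothesis of the inequality for `ν` on the
fibre integrals. -/
theorem PrekopaLeindler.prod {E F : Type*} [AddCommGroup E] [Module ℝ E] [MeasurableSpace E]
    [AddCommGroup F] [Module ℝ F] [MeasurableSpace F] {μ : Measure E} {ν : Measure F}
    [SFinite μ] [SFinite ν] (hμ : PrekopaLeindler μ) (hν : PrekopaLeindler ν) :
    PrekopaLeindler (μ.prod ν) := by
  intro t s ht hs hts f g h hf hg hh H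
  rw [lintegral_prod_symm' _ hf, lintegral_prod_symm' _ hg, lintegral_prod_symm' _ hh]
  refine hν ht hs hts hf.lintegral_prod_left' hg.lintegral_prod_left' hh.lintegral_prod_left'
    fun y y' => ?_
  exact hμ ht hs hts (by fun_prop) (by fun_prop) (by fun_prop) fun x x' => H (x, y) (x', y')

theorem PrekopaLeindler.of_measurePreserving {E F : Type*} [AddCommGroup E] [Module ℝ E]
    [MeasurableSpace E] [AddCommGroup F] [Module ℝ F] [MeasurableSpace F] {μ : Measure E}
    {ν : Measure F} (hμ : PrekopaLeindler μ) (e : E ≃ᵐ F) (he : MeasurePreserving e μ ν)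
    (hlin : ∀ (t s : ℝ) (x y : E), e (t • x + s • y) = t • e x + s • e y) :
    PrekopaLeindler ν := by
  intro t s ht hs hts f g h hf hg hh H
  rw [← he.lintegral_comp hf, ← he.lintegral_comp hg, ← he.lintegral_comp hh]
  refine hμ ht hs hts (hf.comp e.measurable) (hg.comp e.measurable) (hh.comp e.measurable)
    fun x y => ?_
  rw [hlin]
  exact H _ _

theorem prekopaLeindler_pi : ∀ n : ℕ, PrekopaLeindler (volume : Measure (Fin n → ℝ))
  | 0 => by
    intro t s ht hs hts f g h hf hg hh H
    rw [Measure.volume_pi_eq_dirac 0, lintegral_dirac' _ hf, lintegral_dirac' _ hg, lintegral_dirac' _ hh]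
    simpa using H 0 0
  | n + 1 => by
    have h := prekopaLeindler_real.prod (prekopaLeindler_pi n)
    refine h.of_measurePreserving (MeasurableEquiv.piFinSuccAbove (fun _ => ℝ) 0).symm
      (volume_preserving_piFinSuccAbove (fun _ : Fin (n + 1) => ℝ) 0).symm fun t s x y => ?_
    ext i
    refine Fin.cases ?_ (fun j => ?_) i <;> simp [MeasurableEquiv.piFinSuccAbove]

theorem prekopaLeindler_euclideanSpace (n : ℕ) :
    PrekopaLeindler (volume : Measure (EuclideanSpace ℝ (Fin n))) :=
  (prekopaLeindler_pi n).of_measurePreserving (MeasurableEquiv.toLp 2 (Fin n → ℝ))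
    (PiLp.volume_preserving_toLp (Fin n)) fun _ _ _ _ => rfl

section Density

variable {d : ℕ} {X : Set (EuclideanSpace ℝ (Fin d))} {π : Measure (EuclideanSpace ℝ (Fin d))}
  {ρ : EuclideanSpace ℝ (Fin d) → ℝ}

/-! ### Measures given by a density -/

theorem ae_mem_of_compl_null (hπ : π Xᶜ = 0) : ∀ᵐ x ∂π, x ∈ X := hπ

theorem restrict_eq_self_of_compl_null (hπ : π Xᶜ = 0) : π.restrict X = π :=
  Measure.restrict_eq_self_of_ae_mem hπ

theorem integrable_of_continuousOn [IsFiniteMeasure π] (hX : IsCompact X) (hπ : π Xᶜ = 0)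
    {F : Type*} [NormedAddCommGroup F] {φ : EuclideanSpace ℝ (Fin d) → F}
    (hφ : ContinuousOn φ X) : Integrable φ π := by
  have := hφ.integrableOn_compact (μ := π) hX
  rwa [IntegrableOn, restrict_eq_self_of_compl_null hπ] at this

theorem lintegral_ofDensity (hρ : AEMeasurable ρ π) {φ : EuclideanSpace ℝ (Fin d) → ℝ≥0∞}
    (hφ : AEMeasurable φ π) :
    ∫⁻ x, φ x ∂(ofDensity π ρ) = ∫⁻ x, ENNReal.ofReal (ρ x) * φ x ∂π :=
  lintegral_withDensity_eq_lintegral_mul₀ hρ.ennreal_ofReal hφ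

theorem integral_ofDensity (hπ : π Xᶜ = 0) (hρ : AEMeasurable ρ π) (h0 : ∀ x ∈ X, 0 ≤ ρ x)
    (φ : EuclideanSpace ℝ (Fin d) → ℝ) :
    ∫ x, φ x ∂(ofDensity π ρ) = ∫ x, ρ x * φ x ∂π := by
  rw [ofDensity, integral_withDensity_eq_integral_toReal_smul₀ hρ.ennreal_ofReal
    (ae_of_all _ fun x => ENNReal.ofReal_lt_top)]
  refine integral_congr_ae ?_
  filter_upwards [ae_mem_of_compl_null hπ] with x hx
  rw [ENNReal.toReal_ofReal (h0 x hx), smul_eq_mul]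

theorem integral_density_eq_one (hπ : π Xᶜ = 0) (hρ : AEMeasurable ρ π) (h0 : ∀ x ∈ X, 0 ≤ ρ x)
    [IsProbabilityMeasure (ofDensity π ρ)] : ∫ x, ρ x ∂π = 1 := by
  simpa using (integral_ofDensity hπ hρ h0 fun _ => 1).symm

theorem klDiv_ofDensity [IsFiniteMeasure π] [IsFiniteMeasure (ofDensity π ρ)]
    (hπ : π Xᶜ = 0) (hρ : AEMeasurable ρ π) (h0 : ∀ x ∈ X, 0 ≤ ρ x) :
    klDiv (ofDensity π ρ) π = ∫⁻ x, ENNReal.ofReal (klFun (ρ x)) ∂π := by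
  have hac : ofDensity π ρ ≪ π := withDensity_absolutelyContinuous _ _
  rw [klDiv_eq_lintegral_klFun_of_ac hac]
  refine lintegral_congr_ae ?_
  filter_upwards [Measure.rnDeriv_withDensity₀ π hρ.ennreal_ofReal, ae_mem_of_compl_null hπ]
    with x hx hxX
  rw [ofDensity, hx, ENNReal.toReal_ofReal (h0 x hxX)]

theorem klDiv_ofDensity_eq_ofReal [IsFiniteMeasure π] [IsFiniteMeasure (ofDensity π ρ)]
    (hπ : π Xᶜ = 0) (hρ : AEMeasurable ρ π) (h0 : ∀ x ∈ X, 0 ≤ ρ x)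
    (hi : Integrable (fun x => klFun (ρ x)) π) :
    klDiv (ofDensity π ρ) π = ENNReal.ofReal (∫ x, klFun (ρ x) ∂π) := by
  rw [klDiv_ofDensity hπ hρ h0, ofReal_integral_eq_lintegral_ofReal hi]
  filter_upwards [ae_mem_of_compl_null hπ] with x hx
  exact klFun_nonneg (h0 x hx)

theorem lintegral_enorm_sq_ofDensity [IsFiniteMeasure π] (hX : IsCompact X) (hπ : π Xᶜ = 0)
    (hρ : ContinuousOn ρ X) (h0 : ∀ x ∈ X, 0 ≤ ρ x) {F : Type*} [NormedAddCommGroup F]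
    {u : EuclideanSpace ℝ (Fin d) → F} (hu : ContinuousOn u X) :
    ∫⁻ x, ‖u x‖ₑ ^ 2 ∂(ofDensity π ρ) = ENNReal.ofReal (∫ x, ρ x * ‖u x‖ ^ 2 ∂π) := by
  have hu' := (integrable_of_continuousOn hX hπ hu).aestronglyMeasurable
  rw [lintegral_ofDensity (integrable_of_continuousOn hX hπ hρ).aemeasurable
      (hu'.enorm.pow_const 2),
    ofReal_integral_eq_lintegral_ofReal (integrable_of_continuousOn hX hπ (by fun_prop))]
  · refine lintegral_congr_ae ?_
    filter_upwards [ae_mem_of_compl_null hπ] with x hx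
    rw [ENNReal.ofReal_mul (h0 x hx), ENNReal.ofReal_pow (norm_nonneg _), ofReal_norm]
  · filter_upwards [ae_mem_of_compl_null hπ] with x hx
    have := h0 x hx
    positivity

theorem continuousOn_gradientWithin (hXd : UniqueDiffOn ℝ X) (hρ : ContDiffOn ℝ 1 ρ X) :
    ContinuousOn (gradientWithin ρ X) X :=
  (InnerProductSpace.toDual ℝ (EuclideanSpace ℝ (Fin d))).symm.continuous.comp_continuousOn
    (hρ.continuousOn_fderivWithin hXd le_rfl)

theorem norm_gradientWithin (f : EuclideanSpace ℝ (Fin d) → ℝ) (x : EuclideanSpace ℝ (Fin d)) :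
    ‖gradientWithin f X x‖ = ‖fderivWithin ℝ f X x‖ := by
  rw [gradientWithin, LinearIsometryEquiv.norm_map]

end Density

section LogConcave

variable {d : ℕ} {X : Set (EuclideanSpace ℝ (Fin d))} {π : Measure (EuclideanSpace ℝ (Fin d))}

/-! ### The logarithmic Sobolev inequality for log-concave measures -/

theorem measurable_indicator_of_continuousOn {U : Set (EuclideanSpace ℝ (Fin d))} (hU : IsOpen U)
    {φ : EuclideanSpace ℝ (Fin d) → ℝ≥0∞} (hφ : ContinuousOn φ U) :
    Measurable (U.indicator φ) := by
  classical
  rw [← piecewise_eq_indicator]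
  exact hφ.measurable_piecewise continuousOn_const hU.measurableSet

theorem ofDensity_restrict_interior (hX : Convex ℝ X) (V : EuclideanSpace ℝ (Fin d) → ℝ) :
    ofDensity (volume.restrict X) V = ofDensity (volume.restrict (interior X)) V := by
  rw [ofDensity, ofDensity, Measure.restrict_congr_set
    (interior_ae_eq_of_null_frontier (hX.addHaar_frontier volume))]

theorem lintegral_ofDensity_interior {V g : EuclideanSpace ℝ (Fin d) → ℝ}
    (hV : ContinuousOn V (interior X)) (hg : ContinuousOn g (interior X)) :
    ∫⁻ x, ENNReal.ofReal (Real.exp (g x))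
      ∂(ofDensity (volume.restrict (interior X)) fun x => Real.exp (-V x)) =
    ∫⁻ x, (interior X).indicator (fun x => ENNReal.ofReal (Real.exp (g x - V x))) x := by
  rw [lintegral_ofDensity, lintegral_indicator isOpen_interior.measurableSet]
  · refine lintegral_congr fun x => ?_
    rw [← ENNReal.ofReal_mul (Real.exp_nonneg _), ← Real.exp_add]
    congr 2
    ring
  · exact (hV.neg.rexp).aemeasurable isOpen_interior.measurableSet
  · exact (hg.rexp.aemeasurable isOpen_interior.measurableSet).ennreal_ofReal

/-- Prékopa–Leindler for `e^(g/t - V)`, `e^(-V)` and `e^(G - V)` on the interior. At `z = t x + s y`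
one has `x - z = s (x - y)`, so the quadratic penalty equals `t s (λ/2) ‖x - y‖²`, the gain from
strong convexity of `V`. -/
theorem IsLogConcave.rpow_lintegral_exp_le [IsProbabilityMeasure π] {lam : ℝ} (hlam : 0 < lam)
    (h : IsLogConcave X π lam) {t s : ℝ} (ht : 0 < t) (hs : 0 < s) (hts : t + s = 1)
    {g G : EuclideanSpace ℝ (Fin d) → ℝ} (hg : ContinuousOn g X) (hG : ContinuousOn G X)
    (H : ∀ x ∈ X, ∀ z ∈ X, g x - lam * t / (2 * s) * ‖x - z‖ ^ 2 ≤ G z) :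
    (∫⁻ x, ENNReal.ofReal (Real.exp (g x / t)) ∂π) ^ t ≤
      ∫⁻ x, ENNReal.ofReal (Real.exp (G x)) ∂π := by
  obtain ⟨hXc, V, hV, hπV⟩ := h
  have hVc : ContinuousOn V (interior X) :=
    (UniformConvexOn.convexOn hV fun r => by positivity).continuousOn isOpen_interior
  rw [ofDensity_restrict_interior hXc] at hπV
  have hgU := hg.mono interior_subset
  have hGU := hG.mono interior_subset
  -- The case `g = 0` records that `e^(-V)` has integral `1`, which removes the second factor.
  have h1 := lintegral_ofDensity_interior hVc (g := fun _ => (0 : ℝ)) continuousOn_const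
  rw [← hπV] at h1
  simp only [Real.exp_zero, ENNReal.ofReal_one, lintegral_const, measure_univ, mul_one] at h1
  have hm : ∀ {u : EuclideanSpace ℝ (Fin d) → ℝ}, ContinuousOn u (interior X) →
      Measurable ((interior X).indicator fun x => ENNReal.ofReal (Real.exp (u x - V x))) :=
    fun hu => measurable_indicator_of_continuousOn isOpen_interior
      (ENNReal.continuous_ofReal.comp_continuousOn (by fun_prop))
  have key := prekopaLeindler_euclideanSpace d ht hs hts (hm (hgU.div_const t))
    (hm (u := fun _ => 0) continuousOn_const) (hm hGU) ?_
  · rw [← h1, ENNReal.one_rpow, mul_one] at key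
    rw [hπV, lintegral_ofDensity_interior hVc hGU,
      lintegral_ofDensity_interior hVc (hgU.div_const t)]
    exact key
  intro x y
  by_cases hx : x ∈ interior X
  swap; · simp [hx, ht]
  by_cases hy : y ∈ interior X
  swap; · simp [hy, hs]
  have hz : t • x + s • y ∈ interior X := hXc.interior hx hy ht.le hs.le hts
  rw [indicator_of_mem hx, indicator_of_mem hy, indicator_of_mem hz,
    ENNReal.ofReal_rpow_of_pos (Real.exp_pos _), ENNReal.ofReal_rpow_of_pos (Real.exp_pos _),
    ← Real.exp_mul, ← Real.exp_mul, ← ENNReal.ofReal_mul (Real.exp_nonneg _), ← Real.exp_add]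
  refine ENNReal.ofReal_le_ofReal (Real.exp_le_exp.2 ?_)
  have e1 := hV.2 hx hy ht.le hs.le hts
  have e2 := H x (interior_subset hx) _ (interior_subset hz)
  have e3 : x - (t • x + s • y) = s • (x - y) := by
    have : t = 1 - s := by linarith
    rw [this]
    module
  rw [e3, norm_smul, Real.norm_of_nonneg hs.le] at e2
  simp only [smul_eq_mul] at e1
  have e4 : lam * t / (2 * s) * (s * ‖x - y‖) ^ 2 = t * s * (lam / 2 * ‖x - y‖ ^ 2) := by
    field_simp
  have e5 : (g x / t - V x) * t = g x - t * V x := by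
    field_simp
  rw [e5]
  linarith

/-- Uniform continuity of the derivative on the compact set, and the mean value inequality on the
convex set `X ∩ ball z δ`. -/
theorem exists_sub_le_norm_fderivWithin_add_mul (hX : IsCompact X) (hXd : UniqueDiffOn ℝ X)
    (hXc : Convex ℝ X) {g : EuclideanSpace ℝ (Fin d) → ℝ} (hg : ContDiffOn ℝ 1 g X) {ε : ℝ}
    (hε : 0 < ε) :
    ∃ δ > 0, ∀ x ∈ X, ∀ z ∈ X, ‖x - z‖ < δ →
      g x - g z ≤ (‖fderivWithin ℝ g X z‖ + ε) * ‖x - z‖ := by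
  have hc := hg.continuousOn_fderivWithin hXd le_rfl
  obtain ⟨δ, hδ, H⟩ := Metric.uniformContinuousOn_iff.1
    (hX.uniformContinuousOn_of_continuous hc) ε hε
  refine ⟨δ, hδ, fun x hx z hz hxz => ?_⟩
  have hcv : Convex ℝ (X ∩ Metric.ball z δ) := hXc.inter (convex_ball z δ)
  refine (le_abs_self _).trans ?_
  refine hcv.norm_image_sub_le_of_norm_hasFDerivWithin_le (f := g)
    (f' := fderivWithin ℝ g X) (fun y hy => ?_) (fun y hy => ?_) ⟨hz, Metric.mem_ball_self hδ⟩
    ⟨hx, by simpa [dist_eq_norm] using hxz⟩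
  · exact ((hg.differentiableOn one_ne_zero y hy.1).hasFDerivWithinAt).mono inter_subset_left
  · have h1 := H y hy.1 z hz hy.2
    rw [dist_eq_norm] at h1
    have := norm_le_norm_add_norm_sub' (fderivWithin ℝ g X y) (fderivWithin ℝ g X z)
    linarith

/-- Near `z`, maximising `b r - a r²` over `r` gives `b² / (4a)`. At distance at least `δ`, the
choice of `A` makes the penalty exceed the global Lipschitz bound `L r`. -/
theorem exists_bound_sub_mul_sq_le (hX : IsCompact X) (hXd : UniqueDiffOn ℝ X)
    (hXc : Convex ℝ X) {g : EuclideanSpace ℝ (Fin d) → ℝ} (hg : ContDiffOn ℝ 1 g X) {ε : ℝ}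
    (hε : 0 < ε) :
    ∃ A > 0, ∀ a ≥ A, ∀ x ∈ X, ∀ z ∈ X, g x - a * ‖x - z‖ ^ 2 ≤
      g z + (‖fderivWithin ℝ g X z‖ + ε) ^ 2 / (4 * a) := by
  obtain ⟨δ, hδ, H⟩ := exists_sub_le_norm_fderivWithin_add_mul hX hXd hXc hg hε
  obtain ⟨L, hL⟩ := hX.exists_bound_of_continuousOn (hg.continuousOn_fderivWithin hXd le_rfl)
  have hA : 0 < (|L| + 1) / δ := by positivity
  refine ⟨(|L| + 1) / δ, hA, fun a ha x hx z hz => ?_⟩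
  have ha0 : 0 < a := hA.trans_le ha
  rcases lt_or_ge ‖x - z‖ δ with h | h
  · have h1 := H x hx z hz h
    set b := ‖fderivWithin ℝ g X z‖ + ε
    have h2 : b * ‖x - z‖ - a * ‖x - z‖ ^ 2 ≤ b ^ 2 / (4 * a) := by
      rw [le_div_iff₀ (by positivity)]
      nlinarith [sq_nonneg (b - 2 * a * ‖x - z‖)]
    linarith
  · have h1 : g x - g z ≤ L * ‖x - z‖ := (le_abs_self _).trans
      (hXc.norm_image_sub_le_of_norm_hasFDerivWithin_le (f := g) (f' := fderivWithin ℝ g X)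
        (fun y hy => (hg.differentiableOn one_ne_zero y hy).hasFDerivWithinAt) hL hz hx)
    have h2 : L ≤ a * ‖x - z‖ := by
      have : |L| + 1 ≤ a * δ := (div_le_iff₀ hδ).1 ha
      have := mul_le_mul_of_nonneg_left h ha0.le
      linarith [le_abs_self L]
    have h3 := mul_le_mul_of_nonneg_right h2 (norm_nonneg (x - z))
    have h4 : 0 ≤ (‖fderivWithin ℝ g X z‖ + ε) ^ 2 / (4 * a) := by positivity
    nlinarith

end LogConcave

/-! ### From Prékopa–Leindler to the logarithmic Sobolev inequality -/

section LogSobolev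

variable {d : ℕ} {X : Set (EuclideanSpace ℝ (Fin d))} {π : Measure (EuclideanSpace ℝ (Fin d))}

/-- Jensen's inequality for the exponential and the probability measure `ρ π`, obtained by
integrating the tangent line at the mean `m`. -/
theorem exp_integral_mul_le [IsProbabilityMeasure π] (hX : IsCompact X) (hπ : π Xᶜ = 0)
    {ρ : EuclideanSpace ℝ (Fin d) → ℝ} (hρ : ContinuousOn ρ X) (h0 : ∀ x ∈ X, 0 < ρ x)
    (h1 : ∫ x, ρ x ∂π = 1) {u : EuclideanSpace ℝ (Fin d) → ℝ} (hu : ContinuousOn u X) :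
    Real.exp (∫ x, ρ x * u x ∂π) ≤ ∫ x, Real.exp (Real.log (ρ x) + u x) ∂π := by
  set m := ∫ x, ρ x * u x ∂π with hm
  have hlog : ContinuousOn (fun x => Real.log (ρ x)) X := hρ.log fun x hx => (h0 x hx).ne'
  have e : ∫ x, Real.exp m * (ρ x * (1 - m) + ρ x * u x) ∂π = Real.exp m := by
    rw [integral_const_mul, integral_add, integral_mul_const, ← hm, h1]
    · ring
    · exact integrable_of_continuousOn hX hπ (by fun_prop)
    · exact integrable_of_continuousOn hX hπ (by fun_prop)
  rw [← e]
  refine integral_mono_ae (integrable_of_continuousOn hX hπ (by fun_prop))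
    (integrable_of_continuousOn hX hπ (by fun_prop)) ?_
  filter_upwards [ae_mem_of_compl_null hπ] with x hx
  rw [Real.exp_add, Real.exp_log (h0 x hx)]
  have h2 : Real.exp (u x) = Real.exp m * Real.exp (u x - m) := by
    rw [← Real.exp_add]
    congr 1
    ring
  have h3 := Real.add_one_le_exp (u x - m)
  rw [h2]
  have h4 := mul_le_mul_of_nonneg_left h3 (mul_pos (Real.exp_pos m) (h0 x hx)).le
  linarith

/-- Take `g = log ρ` and `t = 1 - s` in `rpow_lintegral_exp_le`. With `E = ∫ ρ log ρ`, Jensen bounds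
the left side below by `e^(sE) ≥ 1 + sE`; expanding `e^(cB)` to second order bounds the right side
by `1 + c ∫ ρ B + c² B₀²`. Since `c` is of order `s`, dividing by `s` leaves an error that vanishes
with `s`. -/
theorem IsLogConcave.entropy_le_of_small [IsProbabilityMeasure π] (hX : IsCompact X)
    (hπ : π Xᶜ = 0) {lam : ℝ} (hlam : 0 < lam) (h : IsLogConcave X π lam)
    {ρ : EuclideanSpace ℝ (Fin d) → ℝ} (hρ : ContinuousOn ρ X) (h0 : ∀ x ∈ X, 0 < ρ x)
    (h1 : ∫ x, ρ x ∂π = 1) {B : EuclideanSpace ℝ (Fin d) → ℝ} (hB : ContinuousOn B X)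
    {B₀ : ℝ} (hB0 : ∀ x ∈ X, ‖B x‖ ≤ B₀) {s : ℝ} (hs : 0 < s) (hs1 : s < 1)
    (hsB : s / (2 * lam * (1 - s)) * B₀ ≤ 1)
    (H : ∀ x ∈ X, ∀ z ∈ X, Real.log (ρ x) - lam * (1 - s) / (2 * s) * ‖x - z‖ ^ 2 ≤
      Real.log (ρ z) + s / (2 * lam * (1 - s)) * B z) :
    ∫ x, ρ x * Real.log (ρ x) ∂π ≤
      (∫ x, ρ x * B x ∂π) / (2 * lam * (1 - s)) + s / (2 * lam * (1 - s)) ^ 2 * B₀ ^ 2 := by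
  have ht : 0 < 1 - s := sub_pos.2 hs1
  set c := s / (2 * lam * (1 - s)) with hc
  have hc0 : 0 < c := by positivity
  have hlog : ContinuousOn (fun x => Real.log (ρ x)) X := hρ.log fun x hx => (h0 x hx).ne'
  have hG : ContinuousOn (fun z => Real.log (ρ z) + c * B z) X := by fun_prop
  have key := h.rpow_lintegral_exp_le hlam ht hs (by ring) hlog hG H
  have hnn : ∀ u : EuclideanSpace ℝ (Fin d) → ℝ, 0 ≤ᵐ[π] fun x => Real.exp (u x) :=
    fun u => ae_of_all _ fun x => Real.exp_nonneg _
  rw [← ofReal_integral_eq_lintegral_ofReal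
      (integrable_of_continuousOn hX hπ (by fun_prop)) (hnn _),
    ← ofReal_integral_eq_lintegral_ofReal
      (integrable_of_continuousOn hX hπ (by fun_prop)) (hnn _)] at key
  have hJ := exp_integral_mul_le hX hπ hρ h0 h1 (u := fun x => s / (1 - s) * Real.log (ρ x))
    (by fun_prop)
  have e1 : ∫ x, Real.exp (Real.log (ρ x) + s / (1 - s) * Real.log (ρ x)) ∂π =
      ∫ x, Real.exp (Real.log (ρ x) / (1 - s)) ∂π := by
    congr 1 with x
    congr 1
    field_simp
    ring
  have e2 : ∫ x, ρ x * (s / (1 - s) * Real.log (ρ x)) ∂π =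
      s / (1 - s) * ∫ x, ρ x * Real.log (ρ x) ∂π := by
    rw [← integral_const_mul]
    congr 1 with x
    ring
  rw [e1, e2] at hJ
  set E := ∫ x, ρ x * Real.log (ρ x) ∂π
  have h2 : Real.exp (s * E) ≤ ∫ x, Real.exp (Real.log (ρ x) + c * B x) ∂π := by
    rw [← ENNReal.ofReal_le_ofReal_iff (integral_nonneg fun x => Real.exp_nonneg _)]
    refine le_trans ?_ key
    have e3 : Real.exp (s * E) = Real.exp (s / (1 - s) * E) ^ (1 - s) := by
      rw [← Real.exp_mul]
      congr 1
      field_simp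
    rw [e3, ← ENNReal.ofReal_rpow_of_pos (Real.exp_pos _)]
    gcongr
  have h3 : ∫ x, Real.exp (Real.log (ρ x) + c * B x) ∂π ≤
      ∫ x, (ρ x * (1 + c ^ 2 * B₀ ^ 2) + c * (ρ x * B x)) ∂π := by
    refine integral_mono_ae (integrable_of_continuousOn hX hπ (by fun_prop))
      (integrable_of_continuousOn hX hπ (by fun_prop)) ?_
    filter_upwards [ae_mem_of_compl_null hπ] with x hx
    rw [Real.exp_add, Real.exp_log (h0 x hx)]
    have h4 : |c * B x| ≤ c * B₀ := by
      rw [abs_mul, abs_of_pos hc0]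
      exact mul_le_mul_of_nonneg_left (hB0 x hx) hc0.le
    have h5 := (abs_le.1 (Real.abs_exp_sub_one_sub_id_le (h4.trans hsB))).2
    have h6 : (c * B x) ^ 2 ≤ (c * B₀) ^ 2 := sq_le_sq' (abs_le.1 h4).1 (abs_le.1 h4).2
    have h7 : Real.exp (c * B x) ≤ 1 + c ^ 2 * B₀ ^ 2 + c * B x := by linarith
    have := mul_le_mul_of_nonneg_left h7 (h0 x hx).le
    linarith
  rw [integral_add (integrable_of_continuousOn hX hπ (by fun_prop))
    (integrable_of_continuousOn hX hπ (by fun_prop)), integral_mul_const, integral_const_mul, h1]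
    at h3
  have h8 := Real.add_one_le_exp (s * E)
  set I := ∫ x, ρ x * B x ∂π
  have h9 : s * E ≤ s * (I / (2 * lam * (1 - s)) + s / (2 * lam * (1 - s)) ^ 2 * B₀ ^ 2) := by
    have : s * (I / (2 * lam * (1 - s)) + s / (2 * lam * (1 - s)) ^ 2 * B₀ ^ 2) =
        c * I + c ^ 2 * B₀ ^ 2 := by
      rw [hc]
      field_simp
    linarith
  exact le_of_mul_le_mul_left h9 hs

/-- As `s → 0+` the penalty coefficient `a = λ(1 - s)/(2s)` tends to infinity, so it eventually
exceeds the threshold `A`; moreover `1/(4a) = s/(2λ(1 - s))`. The slack `ε` is the error in freezing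
the gradient at `z`. -/
theorem IsLogConcave.entropy_le_add [IsProbabilityMeasure π] (hX : IsCompact X)
    (hXd : UniqueDiffOn ℝ X) (hπ : π Xᶜ = 0) {lam : ℝ} (hlam : 0 < lam)
    (h : IsLogConcave X π lam) {ρ : EuclideanSpace ℝ (Fin d) → ℝ} (hρ : ContDiffOn ℝ 1 ρ X)
    (h0 : ∀ x ∈ X, 0 < ρ x) (h1 : ∫ x, ρ x ∂π = 1) {ε : ℝ} (hε : 0 < ε) :
    2 * lam * ∫ x, ρ x * Real.log (ρ x) ∂π ≤
      ∫ x, ρ x * (‖gradientWithin (fun y => Real.log (ρ y)) X x‖ + ε) ^ 2 ∂π := by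
  have hlog : ContDiffOn ℝ 1 (fun x => Real.log (ρ x)) X := hρ.log fun x hx => (h0 x hx).ne'
  have hgrad := continuousOn_gradientWithin hXd hlog
  have hρc := hρ.continuousOn
  set B : EuclideanSpace ℝ (Fin d) → ℝ :=
    fun x => (‖gradientWithin (fun y => Real.log (ρ y)) X x‖ + ε) ^ 2 with hBdef
  have hB : ContinuousOn B X := by fun_prop
  obtain ⟨B₀, hB0⟩ := hX.exists_bound_of_continuousOn hB
  obtain ⟨A, hA, hAb⟩ := exists_bound_sub_mul_sq_le hX hXd h.1 hlog hε
  have hev : ∀ᶠ s : ℝ in 𝓝[>] 0, ∫ x, ρ x * Real.log (ρ x) ∂π ≤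
      (∫ x, ρ x * B x ∂π) / (2 * lam * (1 - s)) + s / (2 * lam * (1 - s)) ^ 2 * B₀ ^ 2 := by
    have c1 : ContinuousAt (fun s : ℝ => s / (2 * lam * (1 - s)) * B₀) 0 := by
      have : (2 * lam * (1 - (0 : ℝ))) ≠ 0 := by simp [hlam.ne']
      fun_prop (disch := assumption)
    have c2 : ContinuousAt (fun s : ℝ => s * (2 * A) - lam * (1 - s)) 0 := by fun_prop
    have e1 : ∀ᶠ s : ℝ in 𝓝[>] 0, s / (2 * lam * (1 - s)) * B₀ < 1 :=
      nhdsWithin_le_nhds (c1.eventually_lt_const (by simp))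
    have e2 : ∀ᶠ s : ℝ in 𝓝[>] 0, s * (2 * A) - lam * (1 - s) < 0 :=
      nhdsWithin_le_nhds (c2.eventually_lt_const (by simp [hlam]))
    filter_upwards [e1, e2, Ioo_mem_nhdsGT (zero_lt_one' ℝ)] with s hs1 hs2 hs
    have hs0 := hs.1
    have ht : 0 < 1 - s := sub_pos.2 hs.2
    refine h.entropy_le_of_small hX hπ hlam hρc h0 h1 hB hB0 hs.1 hs.2 hs1.le fun x hx z hz => ?_
    have h3 := hAb (lam * (1 - s) / (2 * s)) (by
      rw [ge_iff_le, le_div_iff₀ (by positivity)]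
      linarith) x hx z hz
    rw [← norm_gradientWithin] at h3
    refine h3.trans (le_of_eq ?_)
    congr 1
    simp only [hBdef]
    field_simp
    ring
  have hlim : Tendsto (fun s : ℝ => (∫ x, ρ x * B x ∂π) / (2 * lam * (1 - s)) +
      s / (2 * lam * (1 - s)) ^ 2 * B₀ ^ 2) (𝓝[>] 0) (𝓝 ((∫ x, ρ x * B x ∂π) / (2 * lam))) := by
    have hne : (2 * lam * (1 - (0 : ℝ))) ≠ 0 := by simp [hlam.ne']
    have hne2 : (2 * lam * (1 - (0 : ℝ))) ^ 2 ≠ 0 := pow_ne_zero _ hne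
    have c : ContinuousAt (fun s : ℝ => (∫ x, ρ x * B x ∂π) / (2 * lam * (1 - s)) +
      s / (2 * lam * (1 - s)) ^ 2 * B₀ ^ 2) 0 := by fun_prop (disch := assumption)
    have := c.tendsto.mono_left (nhdsWithin_le_nhds (s := Ioi 0))
    simpa using this
  have := ge_of_tendsto hlim hev
  rwa [le_div_iff₀' (by positivity)] at this

theorem IsLogConcave.entropy_le [IsProbabilityMeasure π] (hX : IsCompact X)
    (hXd : UniqueDiffOn ℝ X) (hπ : π Xᶜ = 0) {lam : ℝ} (hlam : 0 < lam)
    (h : IsLogConcave X π lam) {ρ : EuclideanSpace ℝ (Fin d) → ℝ} (hρ : ContDiffOn ℝ 1 ρ X)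
    (h0 : ∀ x ∈ X, 0 < ρ x) (h1 : ∫ x, ρ x ∂π = 1) :
    2 * lam * ∫ x, ρ x * Real.log (ρ x) ∂π ≤
      ∫ x, ρ x * ‖gradientWithin (fun y => Real.log (ρ y)) X x‖ ^ 2 ∂π := by
  have hgrad := continuousOn_gradientWithin hXd (hρ.log fun x hx => (h0 x hx).ne')
  have hρc := hρ.continuousOn
  set D := gradientWithin (fun y => Real.log (ρ y)) X
  have e : ∀ ε : ℝ, ∫ x, ρ x * (‖D x‖ + ε) ^ 2 ∂π =
      ∫ x, ρ x * ‖D x‖ ^ 2 ∂π + ε * (2 * ∫ x, ρ x * ‖D x‖ ∂π) + ε ^ 2 := by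
    intro ε
    have : ∀ x, ρ x * (‖D x‖ + ε) ^ 2 =
        ρ x * ‖D x‖ ^ 2 + (2 * ε) * (ρ x * ‖D x‖) + ε ^ 2 * ρ x := fun x => by ring
    simp_rw [this]
    rw [integral_add (integrable_of_continuousOn hX hπ (by fun_prop))
      (integrable_of_continuousOn hX hπ (by fun_prop)),
      integral_add (integrable_of_continuousOn hX hπ (by fun_prop))
      (integrable_of_continuousOn hX hπ (by fun_prop)), integral_const_mul, integral_const_mul, h1]
    ring
  have c : Continuous fun ε : ℝ =>
      ∫ x, ρ x * ‖D x‖ ^ 2 ∂π + ε * (2 * ∫ x, ρ x * ‖D x‖ ∂π) + ε ^ 2 := by fun_prop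
  have hlim := (c.tendsto 0).mono_left (nhdsWithin_le_nhds (s := Ioi 0))
  simp only [zero_mul, add_zero, ne_eq, OfNat.ofNat_ne_zero, not_false_eq_true, zero_pow] at hlim
  refine ge_of_tendsto hlim ?_
  filter_upwards [self_mem_nhdsWithin] with ε hε
  rw [← e]
  exact h.entropy_le_add hX hXd hπ hlam hρ h0 h1 hε

theorem integral_klFun_eq [IsProbabilityMeasure π] {ρ : EuclideanSpace ℝ (Fin d) → ℝ}
    (hρ : Integrable ρ π) (hl : Integrable (fun x => ρ x * Real.log (ρ x)) π)
    (h1 : ∫ x, ρ x ∂π = 1) :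
    ∫ x, klFun (ρ x) ∂π = ∫ x, ρ x * Real.log (ρ x) ∂π := by
  have hi : Integrable (fun x => ρ x * Real.log (ρ x) + 1) π := hl.add (integrable_const _)
  simp only [klFun_apply]
  rw [integral_sub hi hρ, integral_add hl (integrable_const _), h1]
  simp

/-- The Bakry–Émery criterion on a compact convex set. -/
theorem IsLogConcave.logSobolev [IsProbabilityMeasure π] (hX : IsCompact X)
    (hXd : UniqueDiffOn ℝ X) (hπ : π Xᶜ = 0) {lam : ℝ} (hlam : 0 < lam)
    (h : IsLogConcave X π lam) : LogSobolev X π (2 * lam) := by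
  intro ρ hρ h0 hprob
  have hρc := hρ.continuousOn
  have h0' : ∀ x ∈ X, 0 ≤ ρ x := fun x hx => (h0 x hx).le
  have hlog : ContDiffOn ℝ 1 (fun x => Real.log (ρ x)) X := hρ.log fun x hx => (h0 x hx).ne'
  have hlogc := hlog.continuousOn
  have hρi := integrable_of_continuousOn hX hπ hρc
  have h1 := integral_density_eq_one hπ hρi.aemeasurable h0'
  rw [klDiv_ofDensity_eq_ofReal hπ hρi.aemeasurable h0' (integrable_of_continuousOn hX hπ
      (continuous_klFun.comp_continuousOn hρc)),
    lintegral_enorm_sq_ofDensity hX hπ hρc h0' (continuousOn_gradientWithin hXd hlog),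
    ← ENNReal.ofReal_mul (by positivity),
    integral_klFun_eq hρi (integrable_of_continuousOn hX hπ (by fun_prop)) h1]
  exact ENNReal.ofReal_le_ofReal (h.entropy_le hX hXd hπ hlam hρ h0 h1)

end LogSobolev

/-! ### Positivity of the integral operator of a positive definite kernel -/

section Sampling

variable {Ω : Type*} [MeasurableSpace Ω] {m : Measure Ω} [IsProbabilityMeasure m]

theorem integral_pi_eval_eval {n : ℕ} {i j : Fin n} (hij : i ≠ j) {κ : Ω → Ω → ℝ}
    (hκ : Measurable (Function.uncurry κ)) (hi : Integrable (Function.uncurry κ) (m.prod m)) :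
    ∫ x, κ (x i) (x j) ∂(Measure.pi fun _ : Fin n => m) = ∫ x, ∫ y, κ x y ∂m ∂m := by
  have hind : ProbabilityTheory.IndepFun (fun x : Fin n → Ω => x i) (fun x => x j)
      (Measure.pi fun _ : Fin n => m) :=
    (ProbabilityTheory.iIndepFun_pi (X := fun (_ : Fin n) (y : Ω) => y)
      fun _ => aemeasurable_id).indepFun hij
  have hmap := (ProbabilityTheory.indepFun_iff_map_prod_eq_prod_map_map
    (measurable_pi_apply i).aemeasurable (measurable_pi_apply j).aemeasurable).1 hind
  rw [(measurePreserving_eval (fun _ : Fin n => m) i).map_eq,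
    (measurePreserving_eval (fun _ : Fin n => m) j).map_eq] at hmap
  have e := integral_prod (Function.uncurry κ) hi
  simp only [Function.uncurry_apply_pair] at e
  rw [← e, ← hmap, integral_map (by fun_prop)
    hκ.aestronglyMeasurable]
  rfl

/-- Average the nonnegative double sum over `n` independent points: the `n(n - 1)` off-diagonal
terms each contribute `J`, the diagonal at most `n`. A negative `J` would make the total negative
for large `n`. -/
theorem integral_integral_nonneg_of_posDef {S : Set Ω} (hS : m Sᶜ = 0) {κ : Ω → Ω → ℝ}
    (hκ : Measurable (Function.uncurry κ)) (hb : ∀ x ∈ S, ∀ y ∈ S, |κ x y| ≤ 1)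
    (hpd : ∀ (n : ℕ) (x : Fin n → Ω), (∀ i, x i ∈ S) → 0 ≤ ∑ i, ∑ j, κ (x i) (x j)) :
    0 ≤ ∫ x, ∫ y, κ x y ∂m ∂m := by
  set J := ∫ x, ∫ y, κ x y ∂m ∂m with hJ
  have hSae : ∀ᵐ x ∂m, x ∈ S := hS
  have hprod : Integrable (Function.uncurry κ) (m.prod m) := by
    refine Integrable.of_bound hκ.aestronglyMeasurable 1 ?_
    filter_upwards [Measure.quasiMeasurePreserving_fst.ae hSae,
      Measure.quasiMeasurePreserving_snd.ae hSae] with p h1 h2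
    exact hb _ h1 _ h2
  have key : ∀ n : ℕ, 0 ≤ (n : ℝ) * (n * J) + n * (1 - J) := by
    intro n
    have hae : ∀ᵐ x ∂(Measure.pi fun _ : Fin n => m), ∀ i, x i ∈ S := by
      rw [ae_all_iff]
      exact fun i => (measurePreserving_eval (fun _ : Fin n => m) i).quasiMeasurePreserving.ae hSae
    have hint : ∀ i j : Fin n,
        Integrable (fun x => κ (x i) (x j)) (Measure.pi fun _ : Fin n => m) := by
      intro i j
      have hmeas : Measurable fun x : Fin n → Ω => κ (x i) (x j) :=
        hκ.comp (f := fun x : Fin n → Ω => (x i, x j)) ((measurable_pi_apply i).prodMk (measurable_pi_apply j))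
      refine Integrable.of_bound hmeas.aestronglyMeasurable 1 ?_
      filter_upwards [hae] with x hx
      exact hb _ (hx i) _ (hx j)
    have h0 : 0 ≤ ∫ x, ∑ i, ∑ j, κ (x i) (x j) ∂(Measure.pi fun _ : Fin n => m) := by
      refine integral_nonneg_of_ae ?_
      filter_upwards [hae] with x hx
      exact hpd n x hx
    rw [integral_finsetSum _ fun i _ => integrable_finsetSum _ fun j _ => hint i j] at h0
    simp_rw [integral_finsetSum _ fun j _ => hint _ j] at h0
    refine h0.trans ?_
    calc ∑ i, ∑ j, ∫ x, κ (x i) (x j) ∂(Measure.pi fun _ : Fin n => m)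
        ≤ ∑ i : Fin n, ∑ j : Fin n, (J + if i = j then 1 - J else 0) := by
          gcongr with i _ j _
          split_ifs with h
          · subst h
            have : ∫ x, κ (x i) (x i) ∂(Measure.pi fun _ : Fin n => m) ≤
                ∫ x, 1 ∂(Measure.pi fun _ : Fin n => m) := by
              refine integral_mono_ae (hint i i) (integrable_const _) ?_
              filter_upwards [hae] with x hx
              exact (abs_le.1 (hb _ (hx i) _ (hx i))).2
            simp only [integral_const, probReal_univ, smul_eq_mul, mul_one] at this
            linarith
          · rw [integral_pi_eval_eval h hκ hprod, add_zero]
      _ = _ := by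
          simp [Finset.sum_add_distrib]
  by_contra hneg
  push Not at hneg
  obtain ⟨n, hn⟩ := exists_nat_gt ((1 - J) / (-J))
  rw [div_lt_iff₀ (by linarith)] at hn
  have hn0 : 0 < (n : ℝ) := by
    by_contra h
    have : (n : ℝ) * -J ≤ 0 := mul_nonpos_of_nonpos_of_nonneg (not_lt.1 h) (by linarith)
    linarith
  have := key n
  nlinarith

end Sampling

/-! ### Reduction of the quadratic form on `L²` to a bounded kernel and a probability measure -/

section Kernel

variable {d : ℕ} {X : Set (EuclideanSpace ℝ (Fin d))}
  {k : EuclideanSpace ℝ (Fin d) → EuclideanSpace ℝ (Fin d) → ℝ}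

theorem IsPDKernel.diag_nonneg (hk : IsPDKernel X k) {x : EuclideanSpace ℝ (Fin d)} (hx : x ∈ X) :
    0 ≤ k x x := by
  simpa using hk.nonneg 1 (fun _ => 1) (fun _ => x) fun _ => hx

theorem IsPDKernel.sq_le (hk : IsPDKernel X k) {x y : EuclideanSpace ℝ (Fin d)} (hx : x ∈ X)
    (hy : y ∈ X) : k x y ^ 2 ≤ k x x * k y y := by
  have h : ∀ r : ℝ, 0 ≤ k x x * (r * r) + (2 * k x y) * r + k y y := by
    intro r
    have := hk.nonneg 2 ![r, 1] ![x, y] fun i => by fin_cases i <;> simpa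
    simp only [Fin.sum_univ_two, Matrix.cons_val_zero, Matrix.cons_val_one] at this
    rw [hk.symm y hy x hx] at this
    linarith
  have := discrim_le_zero h
  rw [discrim] at this
  linarith

theorem IsPDKernel.abs_le (hk : IsPDKernel X k) {x y : EuclideanSpace ℝ (Fin d)} (hx : x ∈ X)
    (hy : y ∈ X) : |k x y| ≤ √(k x x) * √(k y y) := by
  rw [← Real.sqrt_mul (hk.diag_nonneg hx), ← Real.sqrt_sq_eq_abs]
  exact Real.sqrt_le_sqrt (hk.sq_le hx hy)

/-- The value `K f` of the integral operator pairs non-negatively with `f`, for `f` measurable. -/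
theorem IsPDKernel.integral_kernelOp_mul_nonneg_of_measurable (hk : IsPDKernel X k)
    (hX : IsCompact X) {f : EuclideanSpace ℝ (Fin d) → ℝ} (hf : Measurable f)
    (hf2 : MemLp f 2 (volume.restrict X)) : 0 ≤ ∫ x in X, kernelOp X k f x * f x := by
  have hkd : Measurable fun x => k x x := hk.measurable.comp (measurable_id.prodMk measurable_id)
  -- Absorb the size of `f` and of the kernel into the integrable weight `a`. The rescaled kernel `w
  -- x * w y * k x y` is then bounded by `1`, and normalising `a dx` gives a probability measure to
  -- sample from. Where `a` vanishes, `w = 0` by the convention for division.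
  set a : EuclideanSpace ℝ (Fin d) → ℝ := fun x => √(k x x) * |f x| with ha
  set w : EuclideanSpace ℝ (Fin d) → ℝ := fun x => f x / a x with hw
  have ham : Measurable a := hkd.sqrt.mul hf.norm
  have hwm : Measurable w := hf.div ham
  have ha0 : ∀ x, 0 ≤ a x := fun x => by positivity
  have hai : IntegrableOn a X := by
    have h2 : MemLp (fun x => √(k x x)) 2 (volume.restrict X) := by
      rw [memLp_two_iff_integrable_sq hkd.sqrt.aestronglyMeasurable]
      refine hk.integrable_diag.congr ?_
      filter_upwards [ae_restrict_mem hX.measurableSet] with x hx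
      rw [Real.sq_sqrt (hk.diag_nonneg hx)]
    exact h2.integrable_mul hf2.abs
  set κ : EuclideanSpace ℝ (Fin d) → EuclideanSpace ℝ (Fin d) → ℝ :=
    fun x y => w x * w y * k x y with hκ
  have hκm : Measurable (Function.uncurry κ) := by
    have h1 := hk.measurable
    have h2 : Function.uncurry κ = fun p => w p.1 * w p.2 * Function.uncurry k p := rfl
    rw [h2]
    fun_prop
  have hpt : ∀ x ∈ X, ∀ y ∈ X, a x * (a y * κ x y) = k x y * f y * f x := by
    intro x hx y hy
    -- If the diagonal vanishes at `x` or `y`, Cauchy–Schwarz forces `k x y = 0`, so nothing is lost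
    -- by `w = 0` there.
    by_cases hx0 : √(k x x) = 0
    · have := hk.abs_le hx hy
      rw [hx0, zero_mul] at this
      simp [hκ, abs_nonpos_iff.1 this]
    by_cases hy0 : √(k y y) = 0
    · have := hk.abs_le hx hy
      rw [hy0, mul_zero] at this
      simp [hκ, abs_nonpos_iff.1 this]
    have e : ∀ z, √(k z z) ≠ 0 → a z * w z = f z := by
      intro z hz
      by_cases hfz : f z = 0
      · simp [hw, hfz]
      · exact mul_div_cancel₀ _ (mul_ne_zero hz (abs_ne_zero.2 hfz))
    calc a x * (a y * κ x y) = (a x * w x) * (a y * w y) * k x y := by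
          simp only [hκ]
          ring
      _ = _ := by
          rw [e x hx0, e y hy0]
          ring
  have hb : ∀ x ∈ X, ∀ y ∈ X, |κ x y| ≤ 1 := by
    intro x hx y hy
    have hs : ∀ z, |w z| ≤ (√(k z z))⁻¹ := by
      intro z
      simp only [hw, ha]
      rw [abs_div, abs_mul, abs_abs, abs_of_nonneg (Real.sqrt_nonneg _), div_mul_eq_div_div_swap,
        div_eq_mul_inv]
      exact mul_le_of_le_one_left (by positivity) (div_self_le_one _)
    have hkxy := hk.abs_le hx hy
    have e : |w x * w y| ≤ (√(k x x) * √(k y y))⁻¹ := by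
      rw [abs_mul, mul_inv]
      exact mul_le_mul (hs x) (hs y) (abs_nonneg _) (by positivity)
    simp only [hκ]
    rw [abs_mul]
    calc |w x * w y| * |k x y| ≤ (√(k x x) * √(k y y))⁻¹ * (√(k x x) * √(k y y)) := by gcongr
      _ ≤ 1 := inv_mul_le_one
  have hpd : ∀ (n : ℕ) (x : Fin n → EuclideanSpace ℝ (Fin d)), (∀ i, x i ∈ X) →
      0 ≤ ∑ i, ∑ j, κ (x i) (x j) := by
    intro n x hx
    refine (hk.nonneg n (fun i => w (x i)) x hx).trans (le_of_eq ?_)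
    refine Finset.sum_congr rfl fun i _ => Finset.sum_congr rfl fun j _ => ?_
    simp only [hκ]
    rw [hk.symm _ (hx i) _ (hx j)]
  set c := ∫ x in X, a x with hc
  have hc0 : 0 ≤ c := integral_nonneg ha0
  have hrw : ∫ x in X, kernelOp X k f x * f x = ∫ x in X, a x * ∫ y in X, a y * κ x y := by
    refine setIntegral_congr_fun hX.measurableSet fun x hx => ?_
    simp only [kernelOp]
    rw [← integral_mul_const, ← integral_const_mul]
    exact setIntegral_congr_fun hX.measurableSet fun y hy => (hpt x hx y hy).symm
  rw [hrw]
  rcases hc0.eq_or_lt with hc0 | hc0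
  · have : a =ᵐ[volume.restrict X] 0 := (integral_eq_zero_iff_of_nonneg ha0 hai).1 hc0.symm
    refine le_of_eq ?_
    rw [integral_congr_ae (g := fun _ => 0), integral_zero]
    filter_upwards [this] with x hx
    simp [hx]
  set m := ofDensity (volume.restrict X) fun x => c⁻¹ * a x with hm
  have hdm : Measurable fun x => ENNReal.ofReal (c⁻¹ * a x) := by fun_prop
  have hmint : ∀ φ : EuclideanSpace ℝ (Fin d) → ℝ, ∫ x, φ x ∂m = c⁻¹ * ∫ x in X, a x * φ x := by
    intro φ
    rw [hm, integral_ofDensity (X := univ) (by simp) (by fun_prop)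
      (fun x _ => mul_nonneg (inv_nonneg.2 hc0.le) (ha0 x)), ← integral_const_mul]
    congr 1 with x
    ring
  have : IsProbabilityMeasure m := by
    refine ⟨?_⟩
    rw [hm, ofDensity, withDensity_apply _ .univ, setLIntegral_univ,
      ← ofReal_integral_eq_lintegral_ofReal (hai.const_mul _)
        (ae_of_all _ fun x => mul_nonneg (inv_nonneg.2 hc0.le) (ha0 x)),
      integral_const_mul, ← hc, inv_mul_cancel₀ hc0.ne', ENNReal.ofReal_one]
  have hmX : m Xᶜ = 0 := by
    refine withDensity_absolutelyContinuous _ _ ?_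
    rw [Measure.restrict_apply hX.measurableSet.compl]
    simp
  have key := integral_integral_nonneg_of_posDef hmX hκm hb hpd
  simp_rw [hmint] at key
  have e : ∫ x in X, a x * (c⁻¹ * ∫ y in X, a y * κ x y) =
      c⁻¹ * ∫ x in X, a x * ∫ y in X, a y * κ x y := by
    rw [← integral_const_mul]
    congr 1 with x
    ring
  rw [e] at key
  have hci : 0 < c⁻¹ := inv_pos.2 hc0
  exact nonneg_of_mul_nonneg_right (nonneg_of_mul_nonneg_right key hci) hci

theorem IsPDKernel.integral_kernelOp_mul_nonneg (hk : IsPDKernel X k) (hX : IsCompact X)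
    {f : EuclideanSpace ℝ (Fin d) → ℝ} (hf : MemLp f 2 (volume.restrict X)) :
    0 ≤ ∫ x in X, kernelOp X k f x * f x := by
  have he := hf.1.aemeasurable.ae_eq_mk
  have h := hk.integral_kernelOp_mul_nonneg_of_measurable hX hf.1.aemeasurable.measurable_mk
    ((memLp_congr_ae he).1 hf)
  refine h.trans (le_of_eq (integral_congr_ae ?_))
  filter_upwards [he] with x hx
  rw [← hx]
  congr 1
  refine integral_congr_ae ?_
  filter_upwards [he] with y hy
  rw [hy]

end Kernel

/-! ### Continuity of the entropy in `L²` -/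

/-- The tangent line of the convex function `klFun`, whose derivative at `u` is `log u`. It comes
from `log (u/v) ≤ u/v - 1`. -/
theorem klFun_add_log_mul_sub_le {u v : ℝ} (hu : 0 < u) (hv : 0 ≤ v) :
    klFun u + Real.log u * (v - u) ≤ klFun v := by
  simp only [klFun_apply]
  rcases hv.eq_or_lt with rfl | hv
  · simp
    linarith
  · have h1 := Real.log_le_sub_one_of_pos (div_pos hu hv)
    rw [Real.log_div hu.ne' hv.ne'] at h1
    have h2 := mul_le_mul_of_nonneg_left h1 hv.le
    have h3 : v * (u / v - 1) = u - v := by field_simp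
    linarith

/-- `klFun` is not Lipschitz at `0`. Its decrease is controlled by `-δ log δ + δ` with `δ = u - v`,
and `-log r ≤ 1/r - 1` at `r = √δ` turns this into a square root. -/
theorem klFun_sub_le_two_mul_sqrt {u v : ℝ} (hv : 0 ≤ v) (huv : v < u) :
    klFun v - klFun u ≤ 2 * √(u - v) := by
  have hδ : 0 < u - v := sub_pos.2 huv
  have hu : 0 < u := hv.trans_lt huv
  have h1 : v * Real.log v ≤ v * Real.log u := by
    rcases hv.eq_or_lt with rfl | hv
    · simp
    · exact mul_le_mul_of_nonneg_left (Real.log_le_log hv huv.le) hv.le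
  have h2 : (u - v) * Real.log (u - v) ≤ (u - v) * Real.log u :=
    mul_le_mul_of_nonneg_left (Real.log_le_log hδ (by linarith)) hδ.le
  set r := √(u - v) with hr
  have hr0 : 0 < r := Real.sqrt_pos.2 hδ
  have hr2 : r ^ 2 = u - v := Real.sq_sqrt hδ.le
  have h3 := Real.log_le_sub_one_of_pos (inv_pos.2 hr0)
  rw [Real.log_inv] at h3
  have h4 : Real.log (u - v) = 2 * Real.log r := by
    rw [← hr2, Real.log_pow]
    norm_num
  rw [h4, ← hr2] at h2
  have h5 : r ^ 2 * (-Real.log r) ≤ r - r ^ 2 := by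
    have h6 := mul_le_mul_of_nonneg_left h3 (sq_nonneg r)
    have h7 : r ^ 2 * (r⁻¹ - 1) = r - r ^ 2 := by
      field_simp
    linarith
  simp only [klFun_apply]
  nlinarith [sq_nonneg r]

theorem sqrt_le_add_sq_div {x η : ℝ} (hx : 0 ≤ x) (hη : 0 < η) : √x ≤ η + x ^ 2 / η ^ 3 := by
  set r := √x with hr
  have hr0 : 0 ≤ r := Real.sqrt_nonneg x
  have hr2 : r ^ 2 = x := Real.sq_sqrt hx
  rcases le_or_gt r η with h | h
  · have : 0 ≤ x ^ 2 / η ^ 3 := by positivity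
    linarith
  · have h1 : r ≤ x ^ 2 / η ^ 3 := by
      rw [le_div_iff₀ (by positivity), ← hr2]
      have : η ^ 3 ≤ r ^ 3 := pow_le_pow_left₀ hη.le h.le 3
      calc r * η ^ 3 ≤ r * r ^ 3 := mul_le_mul_of_nonneg_left this hr0
        _ = (r ^ 2) ^ 2 := by ring
    linarith

/-- The shape suits `L²` convergence: a large constant times `(u - v)²`, plus a small multiple of a
fixed integrable function. The square root near `0` and the cross term `v |u - v|` are both split
with the parameter `η`. -/
theorem abs_klFun_sub_le {u v η : ℝ} (hu : 0 ≤ u) (hv : 0 ≤ v) (hη : 0 < η) :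
    |klFun u - klFun v| ≤ (1 + 1 / η + 2 / η ^ 3) * (u - v) ^ 2 + η * (v ^ 2 + 2) := by
  have main : ∀ a b : ℝ, 0 ≤ a → a < b →
      |klFun b - klFun a| ≤ b * |b - a| + 2 * √|b - a| := by
    intro a b ha hab
    have hb : 0 < b := ha.trans_lt hab
    have h1 := klFun_add_log_mul_sub_le hb ha
    have h2 := klFun_sub_le_two_mul_sqrt ha hab
    have h3 : Real.log b * (b - a) ≤ b * (b - a) :=
      mul_le_mul_of_nonneg_right (by linarith [Real.log_le_sub_one_of_pos hb]) (by linarith)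
    rw [abs_of_pos (sub_pos.2 hab), _root_.abs_le]
    have h4 : 0 ≤ b * (b - a) := mul_nonneg hb.le (by linarith)
    have h5 := Real.sqrt_nonneg (b - a)
    constructor <;> linarith
  have key : |klFun u - klFun v| ≤ (v + |u - v|) * |u - v| + 2 * √|u - v| := by
    rcases lt_trichotomy u v with h | h | h
    · have := main u v hu h
      rw [abs_sub_comm, abs_sub_comm u v]
      have h2 : v * |v - u| ≤ (v + |v - u|) * |v - u| := by
        gcongr
        linarith [abs_nonneg (v - u)]
      linarith
    · simp [h]
    · have h1 := main v u hv h
      have h2 : v + |u - v| = u := by rw [abs_of_pos (sub_pos.2 h)]; ring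
      rwa [h2]
  have h1 := sqrt_le_add_sq_div (abs_nonneg (u - v)) hη
  rw [sq_abs] at h1
  have h2 : v * |u - v| ≤ η * v ^ 2 + (u - v) ^ 2 / η := by
    rw [← sq_abs (u - v)]
    set r := |u - v|
    have : v * r * η ≤ (η * v ^ 2 + r ^ 2 / η) * η := by
      have e : (η * v ^ 2 + r ^ 2 / η) * η = (η * v) ^ 2 + r ^ 2 := by field_simp
      rw [e]
      nlinarith [sq_nonneg (η * v - r), sq_nonneg (η * v), sq_nonneg r]
    exact le_of_mul_le_mul_right this hη
  have h3 : |u - v| * |u - v| = (u - v) ^ 2 := by rw [← sq, sq_abs]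
  have e : (1 + 1 / η + 2 / η ^ 3) * (u - v) ^ 2 =
      (u - v) ^ 2 + (u - v) ^ 2 / η + 2 * ((u - v) ^ 2 / η ^ 3) := by ring
  rw [e]
  linarith

section Entropy

variable {Ω : Type*} [MeasurableSpace Ω] {π : Measure Ω}

theorem integrable_klFun_of_memLp [IsFiniteMeasure π] {ρ : Ω → ℝ} (hρ : MemLp ρ 2 π)
    (h0 : ∀ᵐ x ∂π, 0 ≤ ρ x) : Integrable (fun x => klFun (ρ x)) π := by
  have hd : Integrable (fun x => klFun (ρ x) - klFun 0) π := by
    refine Integrable.mono' (g := fun x => 4 * ρ x ^ 2 + 2)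
      ((hρ.integrable_sq.const_mul 4).add (integrable_const 2))
      ((continuous_klFun.comp_aestronglyMeasurable hρ.1).sub aestronglyMeasurable_const) ?_
    filter_upwards [h0] with x hx
    have := abs_klFun_sub_le hx le_rfl one_pos
    rw [Real.norm_eq_abs]
    refine this.trans (le_of_eq ?_)
    ring
  refine (hd.add (integrable_const (klFun 0))).congr (ae_of_all _ fun x => ?_)
  simp

theorem tendsto_integral_sq_of_tendsto_eLpNorm {ι : Type*} {l : Filter ι} {δ : ι → Ω → ℝ}
    (hδ : ∀ᶠ i in l, MemLp (δ i) 2 π) (h : Tendsto (fun i => eLpNorm (δ i) 2 π) l (𝓝 0)) :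
    Tendsto (fun i => ∫ x, δ i x ^ 2 ∂π) l (𝓝 0) := by
  have h1 : Tendsto (fun i => (eLpNorm (δ i) 2 π ^ 2).toReal) l (𝓝 0) := by
    have h2 := ((ENNReal.continuous_pow 2).tendsto 0).comp h
    have h3 := (ENNReal.tendsto_toReal (a := 0 ^ 2) (by simp)).comp h2
    simpa [Function.comp_def] using h3
  refine h1.congr' ?_
  filter_upwards [hδ] with i hi
  have e := eLpNorm_nnreal_pow_eq_lintegral (f := δ i) (μ := π) (p := 2) two_ne_zero
  simp only [ENNReal.coe_ofNat, NNReal.coe_ofNat, ENNReal.rpow_ofNat] at e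
  rw [e, integral_eq_lintegral_of_nonneg_ae (ae_of_all _ fun x => sq_nonneg _)
    (hi.1.aemeasurable.pow_const 2).aestronglyMeasurable]
  congr 1
  refine lintegral_congr fun x => ?_
  rw [← ofReal_norm, ← ENNReal.ofReal_pow (norm_nonneg _), Real.norm_eq_abs, sq_abs]

theorem tendsto_integral_klFun [IsProbabilityMeasure π] {ι : Type*} {l : Filter ι}
    {ρ : ι → Ω → ℝ} {σ : Ω → ℝ} (hρ : ∀ᶠ i in l, MemLp (ρ i) 2 π ∧ ∀ᵐ x ∂π, 0 ≤ ρ i x)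
    (hσ : MemLp σ 2 π) (hσ0 : ∀ᵐ x ∂π, 0 ≤ σ x)
    (h : Tendsto (fun i => eLpNorm (ρ i - σ) 2 π) l (𝓝 0)) :
    Tendsto (fun i => ∫ x, klFun (ρ i x) ∂π) l (𝓝 (∫ x, klFun (σ x) ∂π)) := by
  have hD := tendsto_integral_sq_of_tendsto_eLpNorm (hρ.mono fun i hi => hi.1.sub hσ) h
  set S := ∫ x, σ x ^ 2 ∂π
  have hS : 0 ≤ S := integral_nonneg fun x => sq_nonneg _
  rw [Metric.tendsto_nhds]
  intro ε hε
  -- Fix `η` first, so that the static term is below `ε/2`; the coefficient of the squared `L²`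
  -- distance is then a constant.
  obtain ⟨η, hη, hηε⟩ : ∃ η : ℝ, 0 < η ∧ η * (S + 2) < ε / 2 := by
    refine ⟨ε / (4 * (S + 2)), by positivity, ?_⟩
    rw [div_mul_eq_mul_div, div_lt_div_iff₀ (by positivity) two_pos]
    nlinarith [mul_pos hε (by linarith : 0 < S + 2)]
  have hC := hD.const_mul (1 + 1 / η + 2 / η ^ 3)
  rw [mul_zero] at hC
  filter_upwards [hρ, hC.eventually_lt_const (half_pos hε)] with i hi hi2
  have hdi := (hi.1.sub hσ).integrable_sq
  simp only [Pi.sub_apply] at hdi hi2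
  have hσi : Integrable (fun x => σ x ^ 2 + 2) π :=
    hσ.integrable_sq.add (integrable_const _)
  have i1 := integrable_klFun_of_memLp hi.1 hi.2
  have i2 := integrable_klFun_of_memLp hσ hσ0
  rw [Real.dist_eq, ← integral_sub i1 i2]
  calc |∫ x, (klFun (ρ i x) - klFun (σ x)) ∂π|
      ≤ ∫ x, |klFun (ρ i x) - klFun (σ x)| ∂π := abs_integral_le_integral_abs
    _ ≤ ∫ x, ((1 + 1 / η + 2 / η ^ 3) * (ρ i x - σ x) ^ 2 + η * (σ x ^ 2 + 2)) ∂π := by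
        refine integral_mono_ae (i1.sub i2).abs ((hdi.const_mul _).add
          (hσi.const_mul _)) ?_
        filter_upwards [hi.2, hσ0] with x hx hx'
        exact abs_klFun_sub_le hx hx' hη
    _ = (1 + 1 / η + 2 / η ^ 3) * ∫ x, (ρ i x - σ x) ^ 2 ∂π + η * (S + 2) := by
        rw [integral_add (hdi.const_mul _) (hσi.const_mul _), integral_const_mul,
          integral_const_mul, integral_add hσ.integrable_sq (integrable_const _)]
        simp [S]
    _ < ε := by linarith

end Entropy

/-! ### A Grönwall inequality for functions with smooth lower supports -/

/-- A lower support at `t` bounds the increments of `F` over `[s, t]` from above for `s < t`. Hence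
time is reversed and the sign changed: `f τ = -e^(c(T - τ)) F(T - τ)` has an upper support `ψ` at
each `τ < T` with slope `e^(c(T - τ)) (c F + D) ≤ 0`, so `f T ≤ f 0`. -/
theorem le_exp_mul_of_forall_support {F : ℝ → ℝ} {c : ℝ} (hF : ContinuousOn F (Ici 0))
    (h : ∀ t, 0 < t → ∃ (Φ : ℝ → ℝ) (D : ℝ), HasDerivAt Φ D t ∧ D ≤ -(c * F t) ∧
      ∀ s, 0 ≤ s → F t + (Φ s - Φ t) ≤ F s) {T : ℝ} (hT : 0 ≤ T) :
    F T ≤ Real.exp (-(c * T)) * F 0 := by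
  set f : ℝ → ℝ := fun τ => -(Real.exp (c * (T - τ)) * F (T - τ)) with hf
  have hfc : ContinuousOn f (Icc 0 T) := by
    have h1 : ContinuousOn (fun τ => F (T - τ)) (Icc 0 T) :=
      hF.comp (by fun_prop) fun τ hτ => sub_nonneg.2 hτ.2
    exact ((Continuous.continuousOn (by fun_prop)).mul h1).neg
  have key := image_le_of_liminf_slope_right_le_deriv_boundary hfc (B := fun _ => f 0)
    (B' := fun _ => 0) le_rfl continuousOn_const (fun x _ => hasDerivWithinAt_const _ _ _) ?_
    (right_mem_Icc.2 hT)
  · simp only [hf, sub_self, mul_zero, Real.exp_zero, one_mul, sub_zero, neg_le_neg_iff] at key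
    rw [Real.exp_neg, inv_mul_eq_div, le_div_iff₀ (Real.exp_pos _)]
    linarith
  intro τ hτ r hr
  have ht : 0 < T - τ := sub_pos.2 hτ.2
  obtain ⟨Φ, D, hΦ, hD, hs⟩ := h (T - τ) ht
  set ψ : ℝ → ℝ := fun z => -(Real.exp (c * (T - z)) * (F (T - τ) + (Φ (T - z) - Φ (T - τ))))
  have hψ : HasDerivAt ψ (Real.exp (c * (T - τ)) * (c * F (T - τ) + D)) τ := by
    have e1 : HasDerivAt (fun z : ℝ => T - z) (-1) τ := by
      simpa using (hasDerivAt_id τ).const_sub T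
    have e2 : HasDerivAt (fun z => Φ (T - z)) (D * -1) τ := hΦ.comp τ e1
    have e3 := ((e1.const_mul c).exp.mul ((e2.sub_const (Φ (T - τ))).const_add (F (T - τ)))).neg
    refine e3.congr_deriv ?_
    ring
  have hψ0 : Real.exp (c * (T - τ)) * (c * F (T - τ) + D) < r :=
    (mul_nonpos_of_nonneg_of_nonpos (Real.exp_nonneg _) (by linarith)).trans_lt hr
  have hev := ((hasDerivAt_iff_tendsto_slope.1 hψ).mono_left
    (nhdsWithin_mono τ (fun z (hz : τ < z) => hz.ne'))).eventually_lt_const hψ0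
  refine Eventually.frequently ?_
  filter_upwards [hev, Ioo_mem_nhdsGT hτ.2] with z hz hzT
  refine lt_of_le_of_lt ?_ hz
  rw [slope_def_field, slope_def_field]
  refine div_le_div_of_nonneg_right ?_ (sub_nonneg.2 hzT.1.le)
  have h2 := mul_le_mul_of_nonneg_left (hs (T - z) (sub_nonneg.2 hzT.2.le))
    (Real.exp_nonneg (c * (T - z)))
  simp only [hf, ψ, sub_self, add_zero]
  linarith

/-! ### Dissipation of the entropy along the flow -/

section Flow

variable {d : ℕ} {X : Set (EuclideanSpace ℝ (Fin d))} {π : Measure (EuclideanSpace ℝ (Fin d))}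
  {k : EuclideanSpace ℝ (Fin d) → EuclideanSpace ℝ (Fin d) → ℝ} {α β : ℝ}
  {μ : ℝ → Measure (EuclideanSpace ℝ (Fin d))}

theorem SolvesSphericalIFTAt.exists_hasDerivAt_le (hX : IsCompact X)
    (hk : IsPDKernel X k) (hβ : 0 < β) (hμ : ∀ s, 0 ≤ s → IsProbabilityMeasure (μ s))
    {ξ : EuclideanSpace ℝ (Fin d) → ℝ} (hξ : ContDiffOn ℝ 1 ξ X) {t : ℝ} (ht : 0 < t)
    (h : SolvesSphericalIFTAt X k α β μ ξ t) :
    ∃ D, HasDerivAt (fun s => ∫ x, ξ x ∂(μ s)) D t ∧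
      D ≤ -(α * ∫ x, ‖gradientWithin ξ X x‖ ^ 2 ∂(μ t)) := by
  obtain ⟨f, g, η, -, -, ⟨hη, hKη⟩, hφ⟩ := h
  have : IsFiniteMeasure (volume.restrict X) := ⟨by simpa using hX.measure_lt_top⟩
  -- Conservation of mass: the test function `1` has no gradient, so the reaction alone must
  -- preserve the total mass.
  have hmass : ∫ x in X, η x = 0 := by
    have h1 := hφ (fun _ => 1) contDiffOn_const
    have h2 : HasDerivAt (fun s => ∫ _, (1 : ℝ) ∂(μ s)) 0 t := by
      refine (hasDerivAt_const t (1 : ℝ)).congr_of_eventuallyEq ?_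
      filter_upwards [Ioi_mem_nhds ht] with s hs
      have := hμ s (le_of_lt hs)
      simp
    have h3 := h1.unique h2
    simp only [gradientWithin, fderivWithin_fun_const, Pi.zero_apply, map_zero, inner_zero_left,
      integral_zero, mul_zero, neg_zero, zero_sub, one_mul, neg_eq_zero, mul_eq_zero] at h3
    exact h3.resolve_left hβ.ne'
  refine ⟨_, hφ ξ hξ, ?_⟩
  simp only [real_inner_self_eq_norm_sq]
  set c := (∫ y in X, f y) / ∫ y in X, g y
  have hηi : Integrable η (volume.restrict X) := hη.integrable one_le_two
  have hξ2 : MemLp (fun x => ξ x - c) 2 (volume.restrict X) := by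
    have hc : ContinuousOn (fun x => ξ x - c) X := hξ.continuousOn.sub continuousOn_const
    obtain ⟨B, hB⟩ := hX.exists_bound_of_continuousOn hc
    exact MemLp.of_bound (hc.aestronglyMeasurable hX.measurableSet) B
      ((ae_restrict_mem hX.measurableSet).mono hB)
  -- Since `η` has zero integral, `ξ` may be replaced by `ξ - c = K η`, and positivity of `K`
  -- applies.
  have hpos : 0 ≤ ∫ x in X, ξ x * η x := by
    have e1 : ∫ x in X, ξ x * η x = ∫ x in X, ((ξ x - c) * η x + c * η x) := by
      congr 1 with x
      ring
    have e2 : ∫ x in X, (ξ x - c) * η x = ∫ x in X, kernelOp X k η x * η x := by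
      refine integral_congr_ae ?_
      filter_upwards [hKη] with x hx
      rw [hx]
    have i1 : Integrable (fun x => (ξ x - c) * η x) (volume.restrict X) := hξ2.integrable_mul hη
    rw [e1, integral_add i1 (hηi.const_mul c), integral_const_mul, hmass,
      mul_zero, add_zero, e2]
    exact hk.integral_kernelOp_mul_nonneg hX hη
  have := mul_nonneg hβ.le hpos
  linarith

theorem LogSobolev.mul_integral_klFun_le [IsProbabilityMeasure π] (hX : IsCompact X)
    (hXd : UniqueDiffOn ℝ X) (hπ : π Xᶜ = 0) {c : ℝ} (hc : 0 ≤ c) (h : LogSobolev X π c)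
    {ρ : EuclideanSpace ℝ (Fin d) → ℝ} (hρ : ContDiffOn ℝ 1 ρ X) (h0 : ∀ x ∈ X, 0 < ρ x)
    [hprob : IsProbabilityMeasure (ofDensity π ρ)] :
    c * ∫ x, klFun (ρ x) ∂π ≤
      ∫ x, ‖gradientWithin (fun y => Real.log (ρ y)) X x‖ ^ 2 ∂(ofDensity π ρ) := by
  have hρc := hρ.continuousOn
  have h0' : ∀ x ∈ X, 0 ≤ ρ x := fun x hx => (h0 x hx).le
  have hlog : ContDiffOn ℝ 1 (fun x => Real.log (ρ x)) X := hρ.log fun x hx => (h0 x hx).ne'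
  have hρi := integrable_of_continuousOn hX hπ hρc
  have key := h ρ hρ h0 hprob
  rw [klDiv_ofDensity_eq_ofReal hπ hρi.aemeasurable h0' (integrable_of_continuousOn hX hπ
      (continuous_klFun.comp_continuousOn hρc)),
    lintegral_enorm_sq_ofDensity hX hπ hρc h0' (continuousOn_gradientWithin hXd hlog),
    ← ENNReal.ofReal_mul hc, ENNReal.ofReal_le_ofReal_iff] at key
  · rwa [integral_ofDensity hπ hρi.aemeasurable h0']
  · refine integral_nonneg_of_ae ?_
    filter_upwards [ae_mem_of_compl_null hπ] with x hx
    have := h0 x hx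
    positivity

/-- The integrated tangent inequality. With `ρ` frozen at time `t` and `σ` the density at time `s`,
it makes `s ↦ ∫ log ρ dμ_s` a lower support of the entropy at `t`. -/
theorem integral_klFun_add_le [IsProbabilityMeasure π] (hX : IsCompact X) (hπ : π Xᶜ = 0)
    {ρ σ : EuclideanSpace ℝ (Fin d) → ℝ} (hρ : ContinuousOn ρ X) (hρ0 : ∀ x ∈ X, 0 < ρ x)
    (hσ : MemLp σ 2 π) (hσ0 : ∀ x ∈ X, 0 ≤ σ x) :
    ∫ x, klFun (ρ x) ∂π + (∫ x, Real.log (ρ x) ∂(ofDensity π σ) -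
      ∫ x, Real.log (ρ x) ∂(ofDensity π ρ)) ≤ ∫ x, klFun (σ x) ∂π := by
  have hlog : ContinuousOn (fun x => Real.log (ρ x)) X := hρ.log fun x hx => (hρ0 x hx).ne'
  have hlog2 : MemLp (fun x => Real.log (ρ x)) 2 π := by
    obtain ⟨B, hB⟩ := hX.exists_bound_of_continuousOn hlog
    exact MemLp.of_bound (integrable_of_continuousOn hX hπ hlog).aestronglyMeasurable B
      ((ae_mem_of_compl_null hπ).mono hB)
  have i1 : Integrable (fun x => σ x * Real.log (ρ x)) π := hσ.integrable_mul hlog2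
  have i2 : Integrable (fun x => ρ x * Real.log (ρ x)) π :=
    integrable_of_continuousOn hX hπ (hρ.mul hlog)
  have i3 : Integrable (fun x => klFun (ρ x)) π :=
    integrable_of_continuousOn hX hπ (continuous_klFun.comp_continuousOn hρ)
  have i4 : Integrable (fun x => σ x * Real.log (ρ x) - ρ x * Real.log (ρ x)) π := i1.sub i2
  have hσ0' : ∀ᵐ x ∂π, 0 ≤ σ x := (ae_mem_of_compl_null hπ).mono hσ0
  rw [integral_ofDensity hπ hσ.1.aemeasurable hσ0, integral_ofDensity hπ
    (integrable_of_continuousOn hX hπ hρ).aemeasurable fun x hx => (hρ0 x hx).le,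
    ← integral_sub i1 i2, ← integral_add i3 i4]
  refine integral_mono_ae (i3.add i4) (integrable_klFun_of_memLp hσ hσ0') ?_
  filter_upwards [ae_mem_of_compl_null hπ] with x hx
  have := klFun_add_log_mul_sub_le (hρ0 x hx) (hσ0 x hx)
  linarith

end Flow

end SIFT

theorem mainTheorem2 {d : ℕ} (X : Set (EuclideanSpace ℝ (Fin d))) (hX : IsCompact X)
    (hXd : UniqueDiffOn ℝ X)
    (k : EuclideanSpace ℝ (Fin d) → EuclideanSpace ℝ (Fin d) → ℝ) (hk : SIFT.IsPDKernel X k)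
    (α β lam : ℝ) (hα : 0 < α) (hβ : 0 < β) (hlam : 0 < lam)
    (π : Measure (EuclideanSpace ℝ (Fin d))) [IsProbabilityMeasure π] (hπ : π Xᶜ = 0)
    (h : SIFT.LogSobolev X π (2 * lam) ∨ SIFT.IsLogConcave X π lam)
    (μ : ℝ → Measure (EuclideanSpace ℝ (Fin d)))
    (hμ : SIFT.IsSphericalIFTFlowKL X k α β π μ)
    (t : ℝ) (ht : 0 ≤ t) :
    klDiv (μ t) π ≤ ENNReal.ofReal (Real.exp (-2 * α * lam * t)) * klDiv (μ 0) π := by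
  have hLS : SIFT.LogSobolev X π (2 * lam) := h.elim id fun h => h.logSobolev hX hXd hπ hlam
  obtain ⟨ρ, h1, h2, h3⟩ := hμ
  have hρ0 : ∀ s, 0 ≤ s → ∀ᵐ x ∂π, 0 ≤ ρ s x := fun s hs =>
    (SIFT.ae_mem_of_compl_null hπ).mono (h2 s hs).1
  have hkl : ∀ s, 0 ≤ s → klDiv (μ s) π = ENNReal.ofReal (∫ x, klFun (ρ s x) ∂π) := by
    intro s hs
    have := (h1 s hs).1
    rw [(h1 s hs).2] at this ⊢
    exact SIFT.klDiv_ofDensity_eq_ofReal hπ (h2 s hs).2.1.1.aemeasurable (h2 s hs).1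
      (SIFT.integrable_klFun_of_memLp (h2 s hs).2.1 (hρ0 s hs))
  have hcont : ContinuousOn (fun s => ∫ x, klFun (ρ s x) ∂π) (Ici 0) := fun s hs =>
    SIFT.tendsto_integral_klFun
      (eventually_mem_nhdsWithin.mono fun r hr => ⟨(h2 r hr).2.1, hρ0 r hr⟩)
      (h2 s hs).2.1 (hρ0 s hs) (h2 s hs).2.2
  rw [hkl t ht, hkl 0 le_rfl, ← ENNReal.ofReal_mul (Real.exp_nonneg _)]
  refine ENNReal.ofReal_le_ofReal ?_
  have e : -2 * α * lam * t = -(2 * α * lam * t) := by ring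
  rw [e]
  refine SIFT.le_exp_mul_of_forall_support hcont (fun s hs => ?_) ht
  obtain ⟨hC, hpos, hsol⟩ := h3 s hs
  obtain ⟨D, hD, hDle⟩ := hsol.exists_hasDerivAt_le hX hk hβ (fun r hr => (h1 r hr).1)
    (hC.log fun x hx => (hpos x hx).ne') hs
  -- The support at time `s` is `r ↦ ∫ log (ρ s) dμ_r`, with the logarithm frozen at `s`.
  refine ⟨_, D, hD, hDle.trans ?_, fun r hr => ?_⟩
  · have := (h1 s hs.le).1
    rw [(h1 s hs.le).2] at this ⊢
    have := mul_le_mul_of_nonneg_left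
      (hLS.mul_integral_klFun_le hX hXd hπ (by positivity) hC hpos) hα.le
    linarith
  · rw [(h1 s hs.le).2, (h1 r hr).2]
    exact SIFT.integral_klFun_add_le hX hπ hC.continuousOn hpos (h2 r hr).2.1 (h2 r hr).1
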